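/- For $\ell\ge 2$ let $O_\ell$ be the Odd graph, that is, the Kneser graph $K(2\ell-1,\ell-1)$: its vertices are the $(\ell-1)$-subsets of a $(2\ell-1)$-set, two of them being adjacent when they are disjoint. Put $d=\ell-1$. Let $\mu_i=(-1)^i(\ell-i)$, $i=0,\dots,d$, be the distinct eigenvalues of (the adjacency matrix of) $O_\ell$, let $m_i$ be the multiplicity of $\mu_i$, and let $\pi_i=\prod_{j\ne i}|\mu_i-\mu_j|$. For a graph $G$, let $\alpha_k(G)$ be the maximum number of vertices that are mutually at distance greater than $k$. Definitions. Let $G$ be a connected regular graph on $n$ vertices with distinct eigenvalues $\theta_0>\theta_1>\dots>\theta_r$ and multiplicities $m(\theta_0),\dots,m(\theta_r)$, such that for every $l\le k$ the number of closed walks of length $l$ at a vertex does not depend on the vertex ($G$ is $k$-partially walk-regular). * A *$k$-minor polynomial* of $G$ is a polynomial $f\in\mathbb R_k[x]$ that minimizes $\sum_i m(\theta_i)f(\theta_i)$ subject to $f(\theta_0)=1$ and $f(\theta_i)\ge 0$ for $i\ge 1$. The ratio-type bound on $\alpha_k(G)$ that it gives is $\operatorname{tr} f(A)=\sum_i m(\theta_i)f(\theta_i)$.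 * A *$k$-sign polynomial* of $G$ is a polynomial $s\in\mathbb R_k[x]$ that, for all sufficiently small $\epsilon>0$ and all sufficiently large integers $M$, is part of an optimal solution $(s,b)$ of the program: minimize $\sum_j m(\theta_j)b_j$ subject to $\sum_j m(\theta_j)s(\theta_j)=0$, $s(\theta_j)-Mb_j+\epsilon\le 0$ and $b_j\in\{0,1\}$ for all $j$. The inertia-type bound on $\alpha_k(G)$ that it gives is $\sum_j m(\theta_j)h(s(\theta_j))$, where $h(x)=1$ for $x\ge 0$ and $h(x)=0$ for $x<0$. * $G$ is a *$k$-Cvetković–Hoffman graph* if it has a $k$-sign polynomial $s$ and a $k$-minor polynomial $f$ that are linearly related, namely $f=\frac{1+s}{1+s(\theta_0)}$ and $s=\frac{n}{\operatorname{tr} f(A)}f-1$, and that give the same bound on $\alpha_k(G)$. **Proposition.** (i) For $d\ge 2$, $$\alpha_{d-1}(O_{d+1})\le 1+m_2\frac{\pi_2}{\pi_0}=\begin{cases}2d+\frac{d-2}{d} & \text{for even } d,\\ 2d+1 & \text{for odd } d.\end{cases}$$ (ii) If $\ell=d+1$ is even ($d\ge 1$), then $O_\ell$ is a $(d-1)$-Cvetković–Hoffman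 graph. Moreover, if in addition $d\ge 2$, then $$\frac{m_1}{m_2}=\frac{\pi_2}{\pi_0}.$$ -/

import Mathlib

/-- The Kneser graph `K(n, k)`: its vertices are the `k`-subsets of an `n`-set, two distinct vertices
being adjacent when they are disjoint. -/
def kneserGraph (n k : ℕ) : SimpleGraph {s : Finset (Fin n) // s.card = k} where
  Adj s t := s ≠ t ∧ Disjoint s.1 t.1
  symm := ⟨fun _ _ h => ⟨h.1.symm, h.2.symm⟩⟩
  loopless := ⟨fun _ h => h.1 rfl⟩

instance (n k : ℕ) : DecidableRel (kneserGraph n k).Adj := fun s t =>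
  inferInstanceAs (Decidable (s ≠ t ∧ Disjoint s.1 t.1))

/-- The Odd graph `O_ℓ = K(2ℓ - 1, ℓ - 1)`, for `ℓ ≥ 2`. -/
abbrev oddGraph (ℓ : ℕ) : SimpleGraph {s : Finset (Fin (2 * ℓ - 1)) // s.card = ℓ - 1} :=
  kneserGraph (2 * ℓ - 1) (ℓ - 1)

/-- The `k`-independence number `α_k` of a finite graph: the maximum number of vertices that are
mutually at distance greater than `k`. -/
noncomputable def kIndepNum {V : Type*} (G : SimpleGraph V) (k : ℕ) : ℕ :=
  sSup {n | ∃ S : Finset V, (S : Set V).Pairwise (fun u v => (k : ℕ∞) < G.edist u v) ∧ S.card = n}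

noncomputable section

section Spectrum

variable {V : Type*} [Fintype V] [DecidableEq V] (G : SimpleGraph V) [DecidableRel G.Adj]

/-- The adjacency operator of `G`. -/
def adjOp : Module.End ℝ (V → ℝ) := Matrix.toLin' (G.adjMatrix ℝ)

/-- The finite set `{θ_0, …, θ_d}` of distinct (adjacency) eigenvalues of `G`. -/
def eigenvalueSet : Finset ℝ :=
  (Module.End.finite_hasEigenvalue (adjOp G)).toFinset

/-- The multiplicity of `θ` as an eigenvalue of `G`. -/
def eigMult (θ : ℝ) : ℕ := Module.finrank ℝ (Module.End.eigenspace (adjOp G) θ)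

/-- The largest eigenvalue `θ_0` of `G`. -/
def maxEigenvalue : ℝ := sSup (eigenvalueSet G : Set ℝ)

/-- The product of the distances `|θ - θ'|` over all the other distinct eigenvalues `θ'` of `G`;
this is `π_i` when `θ` is the eigenvalue with index `i`. -/
def eigPi (θ : ℝ) : ℝ := ∏ θ' ∈ (eigenvalueSet G).erase θ, |θ - θ'|

open Polynomial

/-- The trace `tr p(A) = ∑ᵢ mᵢ p(θᵢ)`. For a polynomial `f` with `f(θ_0) = 1` and nonnegative values
at the other eigenvalues this is the ratio-type bound given by `f`. -/
def ratioBound (p : ℝ[X]) : ℝ := ∑ θ ∈ eigenvalueSet G, (eigMult G θ : ℝ) * p.eval θ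

open Classical in
/-- The inertia-type bound `∑ᵢ mᵢ h(s(θᵢ))` given by a trace-zero polynomial `s`, with `h` the
Heaviside function, `h(x) = 1` for `x ≥ 0` and `h(x) = 0` otherwise. -/
def inertiaBound (s : ℝ[X]) : ℝ :=
  ∑ θ ∈ eigenvalueSet G, (eigMult G θ : ℝ) * (if 0 ≤ s.eval θ then 1 else 0)

/-- Feasible points of the linear program of the `k`-minor polynomial. -/
def MinorFeasible (k : ℕ) (f : ℝ[X]) : Prop :=
  f.natDegree ≤ k ∧ f.eval (maxEigenvalue G) = 1 ∧
    ∀ θ ∈ eigenvalueSet G, θ ≠ maxEigenvalue G → 0 ≤ f.eval θ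

/-- `f` is a `k`-minor polynomial of `G`: an optimal solution of
minimize `∑ᵢ mᵢ f(θᵢ)` over the polynomials `f` of degree at most `k` with `f(θ_0) = 1` and
`f(θᵢ) ≥ 0` for `i ≥ 1`. -/
def IsMinorPolynomial (k : ℕ) (f : ℝ[X]) : Prop :=
  MinorFeasible G k f ∧ ∀ g : ℝ[X], MinorFeasible G k g → ratioBound G f ≤ ratioBound G g

/-- Feasible points `(s, b)` of the mixed-integer linear program of the `k`-sign polynomial, with
parameters `M` and `ε`: `s` has degree at most `k`, `∑ⱼ mⱼ s(θⱼ) = 0`, and for all `j`,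
`bⱼ ∈ {0, 1}` and `s(θⱼ) - M bⱼ + ε ≤ 0`. The variable `bⱼ` is written `b θⱼ`. -/
def SignFeasible (k M : ℕ) (ε : ℝ) (s : ℝ[X]) (b : ℝ → ℝ) : Prop :=
  s.natDegree ≤ k ∧ ∑ θ ∈ eigenvalueSet G, (eigMult G θ : ℝ) * s.eval θ = 0 ∧
    ∀ θ ∈ eigenvalueSet G, (b θ = 0 ∨ b θ = 1) ∧ s.eval θ - M * b θ + ε ≤ 0

/-- The objective `∑ⱼ mⱼ bⱼ` of that program. -/
def signObjective (b : ℝ → ℝ) : ℝ := ∑ θ ∈ eigenvalueSet G, (eigMult G θ : ℝ) * b θ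

/-- `s` is a `k`-sign polynomial of `G`: for all small `ε > 0` and all large integers `M`, it is
the polynomial part of an optimal solution of the program that minimizes `∑ⱼ mⱼ bⱼ`. -/
def IsSignPolynomial (k : ℕ) (s : ℝ[X]) : Prop :=
  ∀ᶠ ε : ℝ in nhdsWithin 0 (Set.Ioi 0), ∀ᶠ M : ℕ in Filter.atTop,
    ∃ b : ℝ → ℝ, SignFeasible G k M ε s b ∧
      ∀ (s' : ℝ[X]) (b' : ℝ → ℝ), SignFeasible G k M ε s' b' →
        signObjective G b ≤ signObjective G b'

/-- `G` is `k`-partially walk-regular: for each `l ≤ k`, the number of closed walks of length `l`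
from a vertex to itself does not depend on the vertex. -/
def IsPartiallyWalkRegular {V : Type*} (G : SimpleGraph V) (k : ℕ) : Prop :=
  ∀ l ≤ k, ∀ u v : V, {p : G.Walk u u | p.length = l}.ncard = {p : G.Walk v v | p.length = l}.ncard

/-- The linear relation between a sign polynomial `s` and a minor polynomial `f`:
`f = (1 + s) / (1 + s(θ_0))` and `s = (n / tr f(A)) f - 1`. -/
def SignMinorRelated (s f : ℝ[X]) : Prop :=
  f = C (1 / (1 + s.eval (maxEigenvalue G))) * (1 + s) ∧
    s = C ((Fintype.card V : ℝ) / ratioBound G f) * f - 1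

/-- `G` is a `k`-Cvetković–Hoffman graph: `G` is a graph to which both bounds on `α_k` apply
(connected, regular and `k`-partially walk-regular), and it has a `k`-sign polynomial and a
`k`-minor polynomial that are linearly related and give the same bound. -/
structure IsCvetkovicHoffman (k : ℕ) : Prop where
  connected : G.Connected
  regular : ∃ r, G.IsRegularOfDegree r
  walkRegular : IsPartiallyWalkRegular G k
  exists_related : ∃ s f : ℝ[X], IsSignPolynomial G k s ∧ IsMinorPolynomial G k f ∧
    SignMinorRelated G s f ∧ inertiaBound G s = ratioBound G f

end Spectrum

/-- The eigenvalue `μ_i = (-1)^i (ℓ - i)` of the Odd graph `O_ℓ`, for `0 ≤ i ≤ ℓ - 1`. These are not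
in decreasing order. -/
def oddMu (ℓ i : ℕ) : ℝ := (-1) ^ i * ((ℓ : ℝ) - i)

/-- The multiplicity `m_i` of the eigenvalue `μ_i` of the Odd graph `O_ℓ`. -/
def oddMult (ℓ i : ℕ) : ℝ := eigMult (oddGraph ℓ) (oddMu ℓ i)

/-- The product `π_i = ∏_{j ≠ i} |μ_i - μ_j|` over the distinct eigenvalues of `O_ℓ`. -/
def oddPi (ℓ i : ℕ) : ℝ := eigPi (oddGraph ℓ) (oddMu ℓ i)

end

/-!
Write `n = 2d + 1`, so that the vertices of `O_{d+1}` are the `d`-subsets of an `n`-set.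

**Spectrum.** For a set `T` let `f_T` be the function `y ↦ [T ⊆ y]` of a vertex `y`
(`inclusionFn`). The adjacency operator sends `f_T`, with `|T| = i`, to `(d + 1 - i)` times
`y ↦ [T ∩ y = ∅]`, which by inclusion-exclusion is `(-1)^i f_T` modulo functions `f_S` with
`S ⊂ T`. Hence the operator is triangular for the filtration by degree, with diagonal entries
`μ_i`, and `m_i` is the dimension of the `i`-th quotient (`finrank_flag_succ`). The `f_T` with
`|T| = i` span the functions of degree at most `i`, and they are independent because raising is
injective below the middle of the Boolean lattice (`eq_zero_of_raise_eq_zero`); so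
`m_i = C(n, i) - C(n, i - 1)`.

**Independence number.** A pair of vertices at distance `d` has exactly `⌊d/2⌋` common elements
(`card_inter_of_lt_edist`). Indicator vectors with constant mutual inner products are linearly
independent, as in Fisher's inequality, whence `α_{d-1} ≤ 2d + 1`. For even `d` the constant
vector `1/2` can be added to the family, and the bound drops to `2d`. The products `π_i` are
evaluated by separating even and odd indices, which gives the stated value of `1 + m_2 π_2 / π_0`.

**The Cvetković–Hoffman property, for odd `d`.** The divided difference of order `d` at the points
`μ_i` vanishes on polynomials of degree less than `d`. Its coefficients `w_i` (`oddWeight`)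
satisfy `|w_i| = 1 / π_i`, `w_0 = 1 / π_0` and `w_1 = -1 / π_0`, the last because `μ_1` is the
smallest eigenvalue and `π_1 = π_0` by the symmetry `x ↦ 1 - x` of the spectrum. Thus `m_i` can be
replaced by `m_i + c w_i` in `tr g(A) = ∑ m_i g(μ_i)`. Since `m_i π_i ≥ m_1 π_1 = 2d π_0` for all
`i ≥ 1` (`le_oddMult_mul_oddPi`), the choice `c = 2d π_0` makes all coefficients nonnegative, that
of `μ_1` zero and that of `μ_0` equal to `2d + 1`. This is a certificate that the polynomial `f`
which is `1` at `μ_0, μ_1` and `0` at the other eigenvalues is a minor polynomial, with trace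
`1 + m_1 = 2d + 1`. The same combination, the one with `c = -π_0`, and the inequality
`m_i ≥ 2d + 1` for `i ≥ 2` show that `2d + 1` is also optimal for the inertia-type program
(`le_signObjective`), where it is attained by `(C(n, d) / (2d + 1)) f - 1`.
-/

/-! ### Raising and lowering on the Boolean lattice -/

section BooleanLattice

variable {α : Type*} [Fintype α] [DecidableEq α]

/-- The raising operator of the Boolean lattice, on real functions of a finite subset. -/
def raise (g : Finset α → ℝ) (y : Finset α) : ℝ := ∑ x ∈ y, g (y.erase x)

/-- The lowering operator of the Boolean lattice, the transpose of `raise`. -/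
def lower (g : Finset α → ℝ) (y : Finset α) : ℝ := ∑ x ∈ yᶜ, g (insert x y)

theorem sum_raise_mul (g h : Finset α → ℝ) :
    ∑ y, raise g y * h y = ∑ y, g y * lower h y := by
  simp only [raise, lower, Finset.sum_mul, Finset.mul_sum]
  rw [Finset.sum_sigma', Finset.sum_sigma']
  refine Finset.sum_bij' (fun p _ => ⟨p.1.erase p.2, p.2⟩) (fun p _ => ⟨insert p.2 p.1, p.2⟩)
    ?_ ?_ ?_ ?_ ?_
  · rintro ⟨y, x⟩ h
    simp at h ⊢
  · rintro ⟨y, x⟩ h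
    simp at h ⊢
  · rintro ⟨y, x⟩ h
    simp at h ⊢
    exact Finset.insert_erase h
  · rintro ⟨y, x⟩ h
    simp at h ⊢
    exact h
  · rintro ⟨y, x⟩ h
    simp only [Finset.mem_sigma, Finset.mem_univ, true_and] at h
    simp only [Finset.insert_erase h]

/-- The commutation relation between lowering and raising. -/
theorem lower_raise (g : Finset α → ℝ) (y : Finset α) :
    lower (raise g) y = raise (lower g) y + ((Fintype.card α : ℝ) - 2 * y.card) * g y := by
  have h1 : lower (raise g) y
      = ∑ x ∈ yᶜ, (g y + ∑ w ∈ y, g (insert x (y.erase w))) := by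
    refine Finset.sum_congr rfl fun x hx => ?_
    have hx : x ∉ y := by simpa using hx
    rw [raise, Finset.sum_insert hx, Finset.erase_insert hx]
    congr 1
    refine Finset.sum_congr rfl fun w hw => ?_
    rw [Finset.erase_insert_of_ne (by rintro rfl; exact hx hw)]
  have h2 : raise (lower g) y
      = ∑ w ∈ y, (g y + ∑ x ∈ yᶜ, g (insert x (y.erase w))) := by
    refine Finset.sum_congr rfl fun w hw => ?_
    rw [lower, Finset.compl_erase, Finset.sum_insert (by simpa using hw), Finset.insert_erase hw]
  rw [h1, h2, Finset.sum_add_distrib, Finset.sum_add_distrib, Finset.sum_comm]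
  simp only [Finset.sum_const, nsmul_eq_mul, Finset.card_compl]
  rw [Nat.cast_sub (Finset.card_le_univ y)]
  ring

/-- Raising is injective on functions supported below the middle level, because
`‖raise g‖² = ‖lower g‖² + (|α| - 2j) ‖g‖²` on level `j`. -/
theorem eq_zero_of_raise_eq_zero {j : ℕ} (hj : 2 * j < Fintype.card α) (g : Finset α → ℝ)
    (hg : ∀ y, y.card ≠ j → g y = 0) (h : ∀ y, raise g y = 0) : g = 0 := by
  have h1 : ∑ y, g y * lower (raise g) y = 0 := by
    rw [← sum_raise_mul]; simp [h]
  have h2 : ∑ y, g y * raise (lower g) y = ∑ y, lower g y * lower g y := by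
    rw [← sum_raise_mul]
    exact Finset.sum_congr rfl fun y _ => mul_comm _ _
  have h3 : ∑ y, g y * lower (raise g) y
      = ∑ y, lower g y * lower g y + ((Fintype.card α : ℝ) - 2 * j) * ∑ y, g y * g y := by
    rw [← h2, Finset.mul_sum, ← Finset.sum_add_distrib]
    refine Finset.sum_congr rfl fun y _ => ?_
    rw [lower_raise]
    by_cases hy : y.card = j
    · rw [hy]; ring
    · rw [hg y hy]; ring
  have h4 : 0 ≤ ∑ y, lower g y * lower g y := Finset.sum_nonneg fun y _ => mul_self_nonneg _
  have h5 : 0 ≤ ∑ y, g y * g y := Finset.sum_nonneg fun y _ => mul_self_nonneg _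
  have h6 : (0 : ℝ) < (Fintype.card α : ℝ) - 2 * j := by
    have : ((2 * j : ℕ) : ℝ) < Fintype.card α := by exact_mod_cast hj
    push_cast at this; linarith
  have h7 : ∑ y, g y * g y = 0 := by
    have h8 := mul_nonneg h6.le h5
    have h9 : ((Fintype.card α : ℝ) - 2 * j) * ∑ y, g y * g y = 0 := by linarith
    exact (mul_eq_zero.1 h9).resolve_left h6.ne'
  funext y
  exact mul_self_eq_zero.1
    ((Finset.sum_eq_zero_iff_of_nonneg fun y _ => mul_self_nonneg (g y)).1 h7 y (Finset.mem_univ y))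

/-- A function on `i`-subsets whose sums over the `i`-subsets of every `d`-subset vanish is zero,
when `i ≤ d` and `2d ≤ |α| + 1`: the inclusion matrix has full rank. -/
theorem eq_zero_of_sum_powersetCard_eq_zero {i d : ℕ} (hid : i ≤ d)
    (hd : 2 * d ≤ Fintype.card α + 1) (a : Finset α → ℝ)
    (h : ∀ y : Finset α, y.card = d → ∑ T ∈ y.powersetCard i, a T = 0) :
    ∀ T : Finset α, T.card = i → a T = 0 := by
  induction d, hid using Nat.le_induction with
  | base =>
    intro T hT
    have := h T hT
    rwa [← hT, Finset.powersetCard_self, Finset.sum_singleton] at this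
  | succ d hid ih =>
    refine ih (by omega) ?_
    set g : Finset α → ℝ := fun y => if y.card = d then ∑ T ∈ y.powersetCard i, a T else 0 with hg
    have hg0 : g = 0 := by
      refine eq_zero_of_raise_eq_zero (j := d) (by omega) g (fun y hy => by simp [hg, hy]) ?_
      intro y
      by_cases hy : y.card = d + 1
      · have h1 : raise g y = ∑ x ∈ y, ∑ T ∈ (y.erase x).powersetCard i, a T := by
          refine Finset.sum_congr rfl fun x hx => ?_
          simp [hg, Finset.card_erase_of_mem hx, hy]
        have h2 : raise g y = ∑ T ∈ y.powersetCard i, ∑ x ∈ y \ T, a T := by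
          rw [h1]
          refine Finset.sum_comm' ?_
          intro x T
          simp only [Finset.mem_powersetCard, Finset.mem_sdiff, Finset.subset_erase]
          tauto
        rw [h2]
        have h3 : ∀ T ∈ y.powersetCard i, ∑ x ∈ y \ T, a T = ((d + 1 - i : ℕ) : ℝ) * a T := by
          intro T hT
          obtain ⟨hT1, hT2⟩ := Finset.mem_powersetCard.1 hT
          rw [Finset.sum_const, Finset.card_sdiff_of_subset hT1, hy, hT2, nsmul_eq_mul]
        rw [Finset.sum_congr rfl h3, ← Finset.mul_sum, h y hy, mul_zero]
      · refine Finset.sum_eq_zero fun x hx => ?_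
        have h1 := Finset.card_erase_add_one hx
        have : (y.erase x).card ≠ d := by omega
        simp [hg, this]
    intro y hy
    have := congrFun hg0 y
    simpa [hg, hy] using this

end BooleanLattice

/-! ### Operators that are triangular with respect to a flag -/

section Flag

variable {E : Type*} [AddCommGroup E] [Module ℝ E]

/-- An eigenvector in step `b` of the flag whose eigenvalue avoids the diagonal entries
of the steps between `a` and `b` already lies in step `a`. -/
theorem mem_flag_of_eigenvector (A : Module.End ℝ E) (W : ℕ → Submodule ℝ E) (μ : ℕ → ℝ)
    {m : ℕ} (hA : ∀ i < m, ∀ w ∈ W (i + 1), A w - μ i • w ∈ W i) {θ : ℝ} {v : E}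
    (hv : A v = θ • v) {a b : ℕ} (hab : a ≤ b) (hbm : b ≤ m)
    (hθ : ∀ i, a ≤ i → i < b → θ ≠ μ i) (hvb : v ∈ W b) : v ∈ W a := by
  induction b, hab using Nat.le_induction with
  | base => exact hvb
  | succ b hab ih =>
    refine ih (by omega) (fun i h1 h2 => hθ i h1 (by omega)) ?_
    have h1 := hA b (by omega) v hvb
    rw [hv, ← sub_smul] at h1
    have h2 : θ - μ b ≠ 0 := sub_ne_zero.2 (hθ b hab (by omega))
    exact (Submodule.smul_mem_iff _ h2).1 h1

theorem exists_eq_of_hasEigenvalue_of_flag (A : Module.End ℝ E) (W : ℕ → Submodule ℝ E)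
    (μ : ℕ → ℝ) {m : ℕ} (h0 : W 0 = ⊥) (hm : W m = ⊤)
    (hA : ∀ i < m, ∀ w ∈ W (i + 1), A w - μ i • w ∈ W i) {θ : ℝ} (hθ : A.HasEigenvalue θ) :
    ∃ i < m, θ = μ i := by
  by_contra! hne
  obtain ⟨v, hv⟩ := hθ.exists_hasEigenvector
  have : v ∈ W 0 := mem_flag_of_eigenvector A W μ hA hv.apply_eq_smul (Nat.zero_le _) le_rfl
    (fun i _ h => hne i h) (hm ▸ Submodule.mem_top)
  rw [h0, Submodule.mem_bot] at this
  exact hv.2 this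

variable [FiniteDimensional ℝ E]

/-- For an operator acting on the `i`-th quotient of a full flag by `μ i`, with distinct `μ i`,
the multiplicity of the eigenvalue `μ i` is the dimension of the `i`-th quotient. -/
theorem finrank_flag_succ (A : Module.End ℝ E) (W : ℕ → Submodule ℝ E) (μ : ℕ → ℝ) {m : ℕ}
    (hmono : Monotone W) (h0 : W 0 = ⊥) (hm : W m = ⊤)
    (hA : ∀ i < m, ∀ w ∈ W (i + 1), A w - μ i • w ∈ W i)
    (hμ : ∀ i < m, ∀ j < m, μ i = μ j → i = j) {i : ℕ} (hi : i < m) :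
    Module.finrank ℝ (W (i + 1))
      = Module.finrank ℝ (W i) + Module.finrank ℝ (Module.End.eigenspace A (μ i)) := by
  set V := Module.End.eigenspace A (μ i) with hV
  have hle : V ≤ W (i + 1) := by
    intro v hv
    refine mem_flag_of_eigenvector A W μ hA (Module.End.mem_eigenspace_iff.1 hv)
      (b := m) hi le_rfl ?_ (hm ▸ Submodule.mem_top)
    intro j h1 h2 h3
    have := hμ i hi j h2 h3
    omega
  have hdisj : ∀ v ∈ W i, v ∈ V → v = 0 := by
    intro v hv1 hv2
    have : v ∈ W 0 := by
      refine mem_flag_of_eigenvector A W μ hA (Module.End.mem_eigenspace_iff.1 hv2)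
        (b := i) (Nat.zero_le _) hi.le ?_ hv1
      intro j h1 h2 h3
      have := hμ i hi j (by omega) h3
      omega
    simpa [h0] using this
  have hstab : ∀ w ∈ W i, (A - algebraMap ℝ _ (μ i)) w ∈ W i := by
    intro w hw
    have := hA i hi w (hmono (Nat.le_succ i) hw)
    simpa [Module.algebraMap_end_apply] using this
  -- The restriction of `A - μ i` to `W i` is injective, hence onto.
  have hsurj : Function.Surjective ((A - algebraMap ℝ _ (μ i)).restrict hstab) := by
    refine LinearMap.surjective_of_injective ?_
    rw [← LinearMap.ker_eq_bot, LinearMap.ker_eq_bot']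
    rintro ⟨w, hw⟩ h
    have h1 := congrArg Subtype.val h
    simp [Module.algebraMap_end_apply, LinearMap.restrict_apply, sub_eq_zero] at h1
    exact Subtype.ext (hdisj w hw (Module.End.mem_eigenspace_iff.2 h1))
  have hsup : W (i + 1) = W i ⊔ V := by
    refine le_antisymm (fun w hw => ?_) (sup_le (hmono (Nat.le_succ i)) hle)
    obtain ⟨⟨u, hu⟩, hu2⟩ := hsurj ⟨A w - μ i • w, hA i hi w hw⟩
    have h1 := congrArg Subtype.val hu2
    simp [Module.algebraMap_end_apply, LinearMap.restrict_apply] at h1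
    refine Submodule.mem_sup.2 ⟨u, hu, w - u, ?_, by abel⟩
    rw [hV, Module.End.mem_eigenspace_iff, map_sub, smul_sub]
    have h2 : A w = A u - μ i • u + μ i • w := by rw [h1]; abel
    rw [h2]; abel
  have h1 := Submodule.finrank_sup_add_finrank_inf_eq (W i) V
  have h2 : W i ⊓ V = ⊥ := (Submodule.eq_bot_iff _).2 fun v hv => hdisj v hv.1 hv.2
  rw [h2, finrank_bot, ← hsup] at h1
  omega

end Flag

/-! ### The filtration of functions of `d`-subsets by degree -/

section Inclusion

/-- The indicator function, on the `d`-subsets, of containing `T`. -/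
def inclusionFn (n d : ℕ) (T : Finset (Fin n)) : {s : Finset (Fin n) // s.card = d} → ℝ :=
  fun y => if T ⊆ y.1 then 1 else 0

/-- The functions of a `d`-subset that have degree less than `i`. -/
def degreeSpan (n d i : ℕ) : Submodule ℝ ({s : Finset (Fin n) // s.card = d} → ℝ) :=
  Submodule.span ℝ (inclusionFn n d '' {T | T.card < i})

variable {n d : ℕ}

theorem inclusionFn_mem {i : ℕ} {T : Finset (Fin n)} (hT : T.card < i) :
    inclusionFn n d T ∈ degreeSpan n d i :=
  Submodule.subset_span ⟨T, hT, rfl⟩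

theorem degreeSpan_mono : Monotone (degreeSpan n d) := fun _ _ h =>
  Submodule.span_mono (Set.image_mono fun _ hT => lt_of_lt_of_le hT h)

theorem degreeSpan_zero : degreeSpan n d 0 = ⊥ := by
  simp [degreeSpan]

theorem degreeSpan_top : degreeSpan n d (d + 1) = ⊤ := by
  rw [eq_top_iff]
  intro f _
  have h : f = ∑ z : {s : Finset (Fin n) // s.card = d}, f z • inclusionFn n d z.1 := by
    funext y
    rw [Finset.sum_apply, Finset.sum_eq_single y]
    · simp [inclusionFn]
    · intro z _ hz
      have : ¬ z.1 ⊆ y.1 := fun h =>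
        hz (Subtype.ext (Finset.eq_of_subset_of_card_le h (by rw [z.2, y.2])))
      simp [inclusionFn, this]
    · simp
  rw [h]
  exact Submodule.sum_mem _ fun z _ =>
    Submodule.smul_mem _ _ (inclusionFn_mem (by rw [z.2]; omega))

/-- A function of degree less than `i` is a combination of the indicators of containing
an `i`-subset. -/
theorem inclusionFn_mem_span_of_card_le {i : ℕ} (hi : i ≤ d) (T : Finset (Fin n))
    (hT : T.card ≤ i) :
    inclusionFn n d T
      ∈ Submodule.span ℝ (Set.range fun T : {T : Finset (Fin n) // T.card = i} =>
          inclusionFn n d T.1) := by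
  induction hk : i - T.card generalizing T with
  | zero => exact Submodule.subset_span ⟨⟨T, by omega⟩, rfl⟩
  | succ k ih =>
    have h1 : ∑ x ∈ Tᶜ, inclusionFn n d (insert x T)
        = ((d - T.card : ℕ) : ℝ) • inclusionFn n d T := by
      funext y
      rw [Finset.sum_apply]
      simp only [inclusionFn, Finset.insert_subset_iff, Pi.smul_apply, smul_eq_mul]
      by_cases hTy : T ⊆ y.1
      · have h2 : Tᶜ.filter (fun x => x ∈ y.1) = y.1 \ T := by
          ext x; simp [and_comm]
        simp only [hTy, and_true, if_true, mul_one]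
        rw [Finset.sum_boole, h2, Finset.card_sdiff_of_subset hTy, y.2]
      · simp [hTy]
    have h3 : ((d - T.card : ℕ) : ℝ) ≠ 0 := by
      rw [Nat.cast_ne_zero]; omega
    rw [← Submodule.smul_mem_iff _ h3, ← h1]
    refine Submodule.sum_mem _ fun x hx => ?_
    have h4 : (insert x T).card = T.card + 1 :=
      Finset.card_insert_of_notMem (by simpa using hx)
    exact ih _ (by omega) (by omega)

theorem linearIndependent_inclusionFn {i : ℕ} (hi : i ≤ d) (hd : 2 * d ≤ n + 1) :
    LinearIndependent ℝ (fun T : {T : Finset (Fin n) // T.card = i} => inclusionFn n d T.1) := by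
  rw [Fintype.linearIndependent_iff]
  intro g hg T
  set a : Finset (Fin n) → ℝ := fun T => if h : T.card = i then g ⟨T, h⟩ else 0 with ha
  have h1 := eq_zero_of_sum_powersetCard_eq_zero hi (by simpa using hd) a ?_ T.1 T.2
  · simpa [ha, T.2] using h1
  · intro y hy
    have h2 := congrFun hg ⟨y, hy⟩
    rw [Finset.sum_apply] at h2
    rw [← h2.trans (Pi.zero_apply _)]
    symm
    have h3 : ∀ T : {T : Finset (Fin n) // T.card = i},
        (g T • inclusionFn n d T.1) ⟨y, hy⟩ = if T.1 ⊆ y then a T.1 else 0 := by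
      intro T
      simp [inclusionFn, ha, T.2]
    rw [Finset.sum_congr rfl fun T _ => h3 T]
    rw [← Finset.sum_subtype (Finset.univ.powersetCard i) (by simp)
      (fun T => if T ⊆ y then a T else 0), ← Finset.sum_filter]
    refine Finset.sum_congr ?_ fun _ _ => rfl
    ext T
    simp [Finset.mem_powersetCard, and_comm]

theorem finrank_degreeSpan {i : ℕ} (hi : i ≤ d) (hd : 2 * d ≤ n + 1) :
    Module.finrank ℝ (degreeSpan n d (i + 1)) = n.choose i := by
  have h1 : degreeSpan n d (i + 1)
      = Submodule.span ℝ (Set.range fun T : {T : Finset (Fin n) // T.card = i} =>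
          inclusionFn n d T.1) := by
    refine le_antisymm (Submodule.span_le.2 ?_) (Submodule.span_le.2 ?_)
    · rintro _ ⟨T, hT, rfl⟩
      exact inclusionFn_mem_span_of_card_le hi T (Nat.lt_succ_iff.1 hT)
    · rintro _ ⟨T, rfl⟩
      exact inclusionFn_mem (by rw [T.2]; omega)
  rw [h1, finrank_span_eq_card (linearIndependent_inclusionFn hi hd), Fintype.card_finset_len,
    Fintype.card_fin]

end Inclusion

/-! ### The spectrum of the Odd graph -/

section OddSpectrum

variable {n d : ℕ}

theorem card_compl_of_card_eq (hn : n = 2 * d + 1) {y : Finset (Fin n)} (hy : y.card = d) :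
    yᶜ.card = d + 1 := by
  rw [Finset.card_compl, Fintype.card_fin, hy]; omega

theorem kneserGraph_adj_iff (hd : 1 ≤ d) {y z : {s : Finset (Fin n) // s.card = d}} :
    (kneserGraph n d).Adj y z ↔ Disjoint y.1 z.1 := by
  refine ⟨fun h => h.2, fun h => ⟨?_, h⟩⟩
  rintro rfl
  have h1 := y.2
  rw [disjoint_self] at h
  rw [h] at h1
  simp at h1
  omega

/-- In the Odd graph the neighbours of `y` are the sets obtained from the complement of `y`
by deleting one point. -/
theorem sum_neighborFinset_oddGraph (hn : n = 2 * d + 1) (hd : 1 ≤ d)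
    (y : {s : Finset (Fin n) // s.card = d}) (F : Finset (Fin n) → ℝ) :
    ∑ z ∈ (kneserGraph n d).neighborFinset y, F z.1 = ∑ x ∈ y.1ᶜ, F (y.1ᶜ.erase x) := by
  symm
  have hc := card_compl_of_card_eq hn y.2
  refine Finset.sum_bij (fun x hx => ⟨y.1ᶜ.erase x, by
      rw [Finset.card_erase_of_mem hx, hc]; rfl⟩) ?_ ?_ ?_ ?_
  · intro x hx
    rw [SimpleGraph.mem_neighborFinset, kneserGraph_adj_iff hd]
    exact Finset.disjoint_of_subset_right (Finset.erase_subset _ _) disjoint_compl_right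
  · intro x hx x' hx' h
    exact Finset.erase_injOn _ hx hx' (congrArg Subtype.val h)
  · intro z hz
    rw [SimpleGraph.mem_neighborFinset, kneserGraph_adj_iff hd] at hz
    have hsub : z.1 ⊆ y.1ᶜ := Finset.subset_compl_iff_disjoint_left.2 hz
    have h1 : (y.1ᶜ \ z.1).card = 1 := by
      rw [Finset.card_sdiff_of_subset hsub, hc, z.2]; omega
    obtain ⟨x, hx⟩ := Finset.card_eq_one.1 h1
    have hxm : x ∈ y.1ᶜ \ z.1 := by rw [hx]; simp
    refine ⟨x, (Finset.mem_sdiff.1 hxm).1, Subtype.ext ?_⟩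
    change y.1ᶜ.erase x = z.1
    rw [Finset.erase_eq, ← hx, Finset.sdiff_sdiff_eq_self hsub]
  · intro x hx; rfl

theorem kneserGraph_isRegularOfDegree (hn : n = 2 * d + 1) (hd : 1 ≤ d) :
    (kneserGraph n d).IsRegularOfDegree (d + 1) := by
  intro y
  have h := sum_neighborFinset_oddGraph hn hd y (fun _ => 1)
  simp only [Finset.sum_const, nsmul_eq_mul, mul_one] at h
  rw [card_compl_of_card_eq hn y.2] at h
  rw [← SimpleGraph.card_neighborFinset_eq_degree]
  exact_mod_cast h

theorem adjOp_inclusionFn (hn : n = 2 * d + 1) (hd : 1 ≤ d) (T : Finset (Fin n)) :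
    adjOp (kneserGraph n d) (inclusionFn n d T)
      = ((d : ℝ) + 1 - T.card) • ∑ S ∈ T.powerset, (-1 : ℝ) ^ S.card • inclusionFn n d S := by
  funext y
  have h1 : adjOp (kneserGraph n d) (inclusionFn n d T) y
      = ∑ x ∈ y.1ᶜ, if T ⊆ y.1ᶜ.erase x then (1 : ℝ) else 0 := by
    rw [adjOp, Matrix.toLin'_apply, SimpleGraph.adjMatrix_mulVec_apply]
    exact sum_neighborFinset_oddGraph hn hd y (fun z => if T ⊆ z then 1 else 0)
  have h2 : (∑ S ∈ T.powerset, (-1 : ℝ) ^ S.card • inclusionFn n d S) y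
      = if T ∩ y.1 = ∅ then 1 else 0 := by
    rw [Finset.sum_apply]
    simp only [Pi.smul_apply, inclusionFn, smul_eq_mul, mul_ite, mul_one, mul_zero]
    rw [← Finset.sum_filter]
    have h3 : T.powerset.filter (fun S => S ⊆ y.1) = (T ∩ y.1).powerset := by
      ext S
      simp only [Finset.mem_filter, Finset.mem_powerset, Finset.subset_inter_iff]
    rw [h3]
    exact_mod_cast congrArg (Int.cast : ℤ → ℝ)
      (Finset.sum_powerset_neg_one_pow_card (x := T ∩ y.1))
  rw [h1, Pi.smul_apply, h2, smul_eq_mul, mul_ite, mul_one, mul_zero]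
  have hiff : T ∩ y.1 = ∅ ↔ T ⊆ y.1ᶜ := by
    rw [Finset.subset_compl_iff_disjoint_right, Finset.disjoint_iff_inter_eq_empty]
  simp only [Finset.subset_erase, hiff]
  by_cases hT : T ⊆ y.1ᶜ
  · simp only [hT, true_and, if_true]
    have h4 : y.1ᶜ.filter (fun x => x ∉ T) = y.1ᶜ \ T := by
      ext x; simp
    rw [Finset.sum_boole, h4, Finset.card_sdiff_of_subset hT, card_compl_of_card_eq hn y.2,
      Nat.cast_sub ((Finset.card_le_card hT).trans (card_compl_of_card_eq hn y.2).le)]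
    push_cast; ring
  · simp [hT]

/-- The adjacency operator acts on functions of degree at most `i`, modulo functions of smaller
degree, as the scalar `μ_i`. -/
theorem adjOp_sub_mem_degreeSpan (hn : n = 2 * d + 1) (hd : 1 ≤ d) {i : ℕ} :
    ∀ w ∈ degreeSpan n d (i + 1),
      adjOp (kneserGraph n d) w - oddMu (d + 1) i • w ∈ degreeSpan n d i := by
  intro w hw
  induction hw using Submodule.span_induction with
  | mem w hw =>
    obtain ⟨T, hT, rfl⟩ := hw
    have hT : T.card < i + 1 := hT
    rw [adjOp_inclusionFn hn hd]
    rcases Nat.lt_succ_iff_lt_or_eq.1 hT with hlt | heq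
    · refine Submodule.sub_mem _ (Submodule.smul_mem _ _ (Submodule.sum_mem _ fun S hS =>
        Submodule.smul_mem _ _ (inclusionFn_mem ?_))) (Submodule.smul_mem _ _ (inclusionFn_mem hlt))
      exact lt_of_le_of_lt (Finset.card_le_card (Finset.mem_powerset.1 hS)) hlt
    · rw [← Finset.sum_erase_add _ _ (Finset.mem_powerset_self T), heq, smul_add, smul_smul]
      have h1 : ((d : ℝ) + 1 - i) * (-1) ^ i = oddMu (d + 1) i := by
        rw [oddMu]; push_cast; ring
      rw [h1, add_sub_cancel_right]
      refine Submodule.smul_mem _ _ (Submodule.sum_mem _ fun S hS =>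
        Submodule.smul_mem _ _ (inclusionFn_mem ?_))
      obtain ⟨h2, h3⟩ := Finset.mem_erase.1 hS
      rw [← heq]
      exact Finset.card_lt_card ((Finset.mem_powerset.1 h3).ssubset_of_ne h2)
  | zero => simp
  | add x y _ _ hx hy =>
    have h := Submodule.add_mem _ hx hy
    rw [map_add, smul_add]
    convert h using 1; abel
  | smul c x _ hx =>
    have h := Submodule.smul_mem _ c hx
    rwa [smul_sub, smul_comm c, ← map_smul] at h

theorem oddMu_injOn {i j : ℕ} (hi : i ≤ d) (hj : j ≤ d) (h : oddMu (d + 1) i = oddMu (d + 1) j) :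
    i = j := by
  have hi' : (i : ℝ) ≤ d := by exact_mod_cast hi
  have hj' : (j : ℝ) ≤ d := by exact_mod_cast hj
  rcases Nat.even_or_odd i with ei | oi <;> rcases Nat.even_or_odd j with ej | oj
  · simp only [oddMu, ei.neg_one_pow, ej.neg_one_pow] at h
    push_cast at h
    exact_mod_cast (by linarith : (i : ℝ) = j)
  · simp only [oddMu, ei.neg_one_pow, oj.neg_one_pow] at h
    push_cast at h; linarith
  · simp only [oddMu, oi.neg_one_pow, ej.neg_one_pow] at h
    push_cast at h; linarith
  · simp only [oddMu, oi.neg_one_pow, oj.neg_one_pow] at h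
    push_cast at h
    exact_mod_cast (by linarith : (i : ℝ) = j)

theorem finrank_degreeSpan_succ (hn : n = 2 * d + 1) (hd : 1 ≤ d) {i : ℕ} (hi : i ≤ d) :
    Module.finrank ℝ (degreeSpan n d (i + 1))
      = Module.finrank ℝ (degreeSpan n d i)
        + eigMult (kneserGraph n d) (oddMu (d + 1) i) :=
  finrank_flag_succ (adjOp (kneserGraph n d)) (degreeSpan n d) (oddMu (d + 1)) (m := d + 1)
    degreeSpan_mono degreeSpan_zero degreeSpan_top
    (fun _ _ => adjOp_sub_mem_degreeSpan hn hd)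
    (fun _ hi _ hj h => oddMu_injOn (Nat.lt_succ_iff.1 hi) (Nat.lt_succ_iff.1 hj) h)
    (Nat.lt_succ_iff.2 hi)

theorem eigMult_kneserGraph_zero (hn : n = 2 * d + 1) (hd : 1 ≤ d) :
    eigMult (kneserGraph n d) (oddMu (d + 1) 0) = 1 := by
  have h := finrank_degreeSpan_succ hn hd (Nat.zero_le d)
  rw [finrank_degreeSpan (Nat.zero_le d) (by omega), degreeSpan_zero, finrank_bot] at h
  simpa using h.symm

theorem eigMult_kneserGraph_succ (hn : n = 2 * d + 1) (hd : 1 ≤ d) {i : ℕ} (hi : i + 1 ≤ d) :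
    n.choose (i + 1) = n.choose i + eigMult (kneserGraph n d) (oddMu (d + 1) (i + 1)) := by
  have h := finrank_degreeSpan_succ hn hd hi
  rwa [finrank_degreeSpan hi (by omega), finrank_degreeSpan (by omega) (by omega)] at h

theorem eigenvalueSet_kneserGraph (hn : n = 2 * d + 1) (hd : 1 ≤ d) :
    eigenvalueSet (kneserGraph n d) = (Finset.range (d + 1)).image (oddMu (d + 1)) := by
  ext θ
  rw [eigenvalueSet, Set.Finite.mem_toFinset, Finset.mem_image]
  constructor
  · intro h
    obtain ⟨i, hi, h⟩ := exists_eq_of_hasEigenvalue_of_flag (adjOp (kneserGraph n d))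
      (degreeSpan n d) (oddMu (d + 1)) (m := d + 1) degreeSpan_zero degreeSpan_top
      (fun _ _ => adjOp_sub_mem_degreeSpan hn hd) h
    exact ⟨i, Finset.mem_range.2 hi, h.symm⟩
  · rintro ⟨i, hi, rfl⟩
    have hi : i ≤ d := Nat.lt_succ_iff.1 (Finset.mem_range.1 hi)
    have hpos : 0 < eigMult (kneserGraph n d) (oddMu (d + 1) i) := by
      rcases Nat.eq_zero_or_pos i with rfl | h0
      · rw [eigMult_kneserGraph_zero hn hd]; exact one_pos
      · obtain ⟨j, rfl⟩ : ∃ j, i = j + 1 := ⟨i - 1, by omega⟩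
        have h1 := eigMult_kneserGraph_succ hn hd hi
        have h2 : n.choose j < n.choose (j + 1) := by
          have h3 := Nat.choose_succ_right_eq n j
          have h4 : 0 < n.choose j := Nat.choose_pos (by omega)
          by_contra! hle
          have h5 : n.choose (j + 1) * (j + 1) ≤ n.choose j * (j + 1) :=
            Nat.mul_le_mul_right _ hle
          have h6 : n.choose j * (j + 1) < n.choose j * (n - j) :=
            Nat.mul_lt_mul_of_pos_left (by omega) h4
          omega
        omega
    intro hbot
    have hbot : Module.End.eigenspace (adjOp (kneserGraph n d)) (oddMu (d + 1) i) = ⊥ := hbot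
    rw [eigMult, hbot, finrank_bot] at hpos
    exact absurd hpos (lt_irrefl 0)

theorem eigenvalueSet_oddGraph (hd : 1 ≤ d) :
    eigenvalueSet (oddGraph (d + 1)) = (Finset.range (d + 1)).image (oddMu (d + 1)) :=
  eigenvalueSet_kneserGraph (n := 2 * (d + 1) - 1) (d := d) rfl hd

theorem oddMult_zero (hd : 1 ≤ d) : oddMult (d + 1) 0 = 1 := by
  have h : eigMult (oddGraph (d + 1)) (oddMu (d + 1) 0) = 1 :=
    eigMult_kneserGraph_zero (n := 2 * (d + 1) - 1) (d := d) rfl hd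
  rw [oddMult, h, Nat.cast_one]

theorem oddMult_succ (hd : 1 ≤ d) {i : ℕ} (hi : i + 1 ≤ d) :
    oddMult (d + 1) (i + 1) = (2 * d + 1).choose (i + 1) - (2 * d + 1).choose i := by
  have h : (2 * d + 1).choose (i + 1)
      = (2 * d + 1).choose i + eigMult (oddGraph (d + 1)) (oddMu (d + 1) (i + 1)) :=
    eigMult_kneserGraph_succ (n := 2 * (d + 1) - 1) (d := d) rfl hd hi
  rw [oddMult, h]; push_cast; ring

theorem sum_oddMult (hd : 1 ≤ d) :
    ∑ i ∈ Finset.range (d + 1), oddMult (d + 1) i = (2 * d + 1).choose d := by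
  have h : ∀ k ≤ d, ∑ i ∈ Finset.range (k + 1), oddMult (d + 1) i = (2 * d + 1).choose k := by
    intro k hk
    induction k with
    | zero => simp [oddMult_zero hd]
    | succ k ih => rw [Finset.sum_range_succ, ih (by omega), oddMult_succ hd hk]; ring
  exact h d le_rfl

theorem maxEigenvalue_oddGraph (hd : 1 ≤ d) :
    maxEigenvalue (oddGraph (d + 1)) = oddMu (d + 1) 0 := by
  rw [maxEigenvalue, eigenvalueSet_oddGraph hd]
  refine IsGreatest.csSup_eq ⟨?_, ?_⟩
  · simp only [Finset.mem_coe, Finset.mem_image, Finset.mem_range]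
    exact ⟨0, by omega, rfl⟩
  · intro θ hθ
    simp only [Finset.mem_coe, Finset.mem_image, Finset.mem_range] at hθ
    obtain ⟨i, hi, rfl⟩ := hθ
    have hi' : (i : ℝ) ≤ d := by exact_mod_cast Nat.lt_succ_iff.1 hi
    have h0 : (0 : ℝ) ≤ i := i.cast_nonneg
    rcases neg_one_pow_eq_or ℝ i with h | h <;> simp only [oddMu, h] <;> push_cast <;> linarith

/-- Sums over the spectrum of the Odd graph, rewritten as sums over the index of the
eigenvalue. -/
theorem sum_eigenvalueSet_oddGraph (hd : 1 ≤ d) (F : ℝ → ℝ) :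
    ∑ θ ∈ eigenvalueSet (oddGraph (d + 1)), (eigMult (oddGraph (d + 1)) θ : ℝ) * F θ
      = ∑ i ∈ Finset.range (d + 1), oddMult (d + 1) i * F (oddMu (d + 1) i) := by
  rw [eigenvalueSet_oddGraph hd, Finset.sum_image]
  · rfl
  · intro i hi j hj h
    exact oddMu_injOn (Finset.mem_range_succ_iff.1 hi) (Finset.mem_range_succ_iff.1 hj) h

theorem oddPi_eq_prod (hd : 1 ≤ d) {i : ℕ} (hi : i ≤ d) :
    oddPi (d + 1) i
      = ∏ j ∈ (Finset.range (d + 1)).erase i, |oddMu (d + 1) i - oddMu (d + 1) j| := by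
  have hinj : Set.InjOn (oddMu (d + 1)) (Finset.range (d + 1) : Set ℕ) := by
    intro i hi j hj h
    simp only [Finset.coe_range, Set.mem_Iio] at hi hj
    exact oddMu_injOn (Nat.lt_succ_iff.1 hi) (Nat.lt_succ_iff.1 hj) h
  have h1 : (eigenvalueSet (oddGraph (d + 1))).erase (oddMu (d + 1) i)
      = ((Finset.range (d + 1)).erase i).image (oddMu (d + 1)) := by
    rw [eigenvalueSet_oddGraph hd]
    ext θ
    simp only [Finset.mem_erase, Finset.mem_image, Finset.mem_range]
    constructor
    · rintro ⟨h1, j, hj, rfl⟩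
      exact ⟨j, ⟨fun h => h1 (by rw [h]), hj⟩, rfl⟩
    · rintro ⟨j, ⟨h1, h2⟩, rfl⟩
      exact ⟨fun h => h1 (oddMu_injOn (Nat.lt_succ_iff.1 h2) hi h), j, h2, rfl⟩
  rw [oddPi, eigPi, h1, Finset.prod_image]
  exact fun a ha b hb h => hinj (Finset.mem_of_mem_erase ha) (Finset.mem_of_mem_erase hb) h

end OddSpectrum

/-! ### Distances and symmetry of the Odd graph -/

section OddMetric

variable {n d : ℕ}

theorem edist_le_one_of_disjoint (hd : 1 ≤ d) {u v : {s : Finset (Fin n) // s.card = d}}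
    (h : Disjoint u.1 v.1) : (kneserGraph n d).edist u v ≤ 1 := by
  have h := (kneserGraph_adj_iff hd).2 h
  simpa using SimpleGraph.Walk.edist_le h.toWalk

/-- Two steps of the Odd graph exchange one element, so `d - r` common elements give
distance at most `2r`. -/
theorem edist_le_of_card_inter_add (hn : n = 2 * d + 1) (hd : 1 ≤ d) (r : ℕ)
    (u v : {s : Finset (Fin n) // s.card = d}) (h : (u.1 ∩ v.1).card + r = d) :
    (kneserGraph n d).edist u v ≤ (2 * r : ℕ) := by
  induction r generalizing u with
  | zero =>
    have h1 : u.1 ∩ v.1 = u.1 :=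
      Finset.eq_of_subset_of_card_le Finset.inter_subset_left (by rw [u.2]; omega)
    have h2 : u.1 ∩ v.1 = v.1 :=
      Finset.eq_of_subset_of_card_le Finset.inter_subset_right (by rw [v.2]; omega)
    have : u = v := Subtype.ext (h1.symm.trans h2)
    simp [this]
  | succ r ih =>
    have h1 : 0 < (u.1 \ v.1).card := by
      have := Finset.card_sdiff_add_card_inter u.1 v.1
      have := u.2
      omega
    have h2 : 0 < (v.1 \ u.1).card := by
      have := Finset.card_sdiff_add_card_inter v.1 u.1
      rw [Finset.inter_comm] at this
      have := v.2
      omega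
    obtain ⟨a, ha⟩ := Finset.card_pos.1 h1
    obtain ⟨b, hb⟩ := Finset.card_pos.1 h2
    rw [Finset.mem_sdiff] at ha hb
    have hw : ((insert b u.1)ᶜ).card = d := by
      rw [Finset.card_compl, Finset.card_insert_of_notMem hb.2, u.2, Fintype.card_fin]
      omega
    have hu' : (insert b (u.1.erase a)).card = d := by
      rw [Finset.card_insert_of_notMem (fun h => hb.2 (Finset.mem_of_mem_erase h)),
        Finset.card_erase_of_mem ha.1, u.2]
      omega
    have hi : ((insert b (u.1.erase a)) ∩ v.1).card + r = d := by
      have h3 : (insert b (u.1.erase a)) ∩ v.1 = insert b (u.1 ∩ v.1) := by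
        ext x
        simp only [Finset.mem_inter, Finset.mem_insert, Finset.mem_erase]
        constructor
        · rintro ⟨rfl | h, hx⟩
          · exact Or.inl rfl
          · exact Or.inr ⟨h.2, hx⟩
        · rintro (rfl | h)
          · exact ⟨Or.inl rfl, hb.1⟩
          · exact ⟨Or.inr ⟨fun hx => ha.2 (hx ▸ h.2), h.1⟩, h.2⟩
      rw [h3, Finset.card_insert_of_notMem (fun h => hb.2 (Finset.mem_inter.1 h).1)]
      omega
    have e1 : (kneserGraph n d).edist u ⟨(insert b u.1)ᶜ, hw⟩ ≤ 1 :=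
      edist_le_one_of_disjoint hd
        (Finset.disjoint_of_subset_left (Finset.subset_insert b u.1) disjoint_compl_right)
    have e2 : (kneserGraph n d).edist ⟨(insert b u.1)ᶜ, hw⟩ ⟨insert b (u.1.erase a), hu'⟩ ≤ 1 :=
      edist_le_one_of_disjoint hd
        (Finset.disjoint_of_subset_right (Finset.insert_subset_insert b (Finset.erase_subset _ _))
          disjoint_compl_left)
    have e3 := ih ⟨insert b (u.1.erase a), hu'⟩ hi
    calc (kneserGraph n d).edist u v
        ≤ (kneserGraph n d).edist u ⟨(insert b u.1)ᶜ, hw⟩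
          + ((kneserGraph n d).edist ⟨(insert b u.1)ᶜ, hw⟩ ⟨insert b (u.1.erase a), hu'⟩
            + (kneserGraph n d).edist ⟨insert b (u.1.erase a), hu'⟩ v) :=
          SimpleGraph.edist_triangle.trans (add_le_add le_rfl SimpleGraph.edist_triangle)
      _ ≤ 1 + (1 + (2 * r : ℕ)) := add_le_add e1 (add_le_add e2 e3)
      _ = (2 * (r + 1) : ℕ) := by
          have : 2 * (r + 1) = 1 + (1 + 2 * r) := by ring
          rw [this]; push_cast; rfl

theorem edist_le_of_card_inter (hn : n = 2 * d + 1) (hd : 1 ≤ d)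
    (u v : {s : Finset (Fin n) // s.card = d}) :
    (kneserGraph n d).edist u v ≤ (2 * (u.1 ∩ v.1).card + 1 : ℕ) := by
  have h1 := Finset.card_sdiff_add_card_inter v.1 u.1
  rw [Finset.inter_comm, v.2] at h1
  obtain ⟨w, hw1, hw2, hw3⟩ := Finset.exists_subsuperset_card_eq (n := d)
    (Finset.subset_compl_iff_disjoint_right.2 (Finset.sdiff_disjoint (s := u.1) (t := v.1)))
    (by omega) (by rw [card_compl_of_card_eq hn u.2]; omega)
  have h2 : w ∩ v.1 = v.1 \ u.1 := by
    ext x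
    rw [Finset.mem_inter, Finset.mem_sdiff]
    exact ⟨fun h => ⟨h.2, Finset.mem_compl.1 (hw2 h.1)⟩,
      fun h => ⟨hw1 (Finset.mem_sdiff.2 h), h.1⟩⟩
  have e1 : (kneserGraph n d).edist u ⟨w, hw3⟩ ≤ 1 :=
    edist_le_one_of_disjoint hd (Finset.subset_compl_iff_disjoint_left.1 hw2)
  have e2 := edist_le_of_card_inter_add hn hd (u.1 ∩ v.1).card ⟨w, hw3⟩ v (by
    change (w ∩ v.1).card + _ = d
    rw [h2]; omega)
  calc (kneserGraph n d).edist u v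
      ≤ (kneserGraph n d).edist u ⟨w, hw3⟩ + (kneserGraph n d).edist ⟨w, hw3⟩ v :=
        SimpleGraph.edist_triangle
    _ ≤ 1 + (2 * (u.1 ∩ v.1).card : ℕ) := add_le_add e1 e2
    _ = (2 * (u.1 ∩ v.1).card + 1 : ℕ) := by rw [add_comm]; push_cast; rfl

theorem kneserGraph_connected (hn : n = 2 * d + 1) (hd : 1 ≤ d) : (kneserGraph n d).Connected := by
  have hne : Nonempty {s : Finset (Fin n) // s.card = d} := by
    obtain ⟨t, _, ht⟩ := Finset.exists_subset_card_eq (s := (Finset.univ : Finset (Fin n)))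
      (n := d) (by rw [Finset.card_univ, Fintype.card_fin]; omega)
    exact ⟨⟨t, ht⟩⟩
  refine SimpleGraph.connected_iff _ |>.2 ⟨fun u v => ?_, hne⟩
  rw [← SimpleGraph.edist_ne_top_iff_reachable]
  exact ne_top_of_le_ne_top (ENat.natCast_ne_top _) (edist_le_of_card_inter hn hd u v)

/-- Two vertices of the Odd graph at distance `d`, its diameter, have `⌊d/2⌋` common elements. -/
theorem card_inter_of_lt_edist (hn : n = 2 * d + 1) (hd : 1 ≤ d)
    {u v : {s : Finset (Fin n) // s.card = d}}
    (h : ((d - 1 : ℕ) : ℕ∞) < (kneserGraph n d).edist u v) : (u.1 ∩ v.1).card = d / 2 := by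
  have h0 : (u.1 ∩ v.1).card ≤ d := by
    have := Finset.card_le_card (Finset.inter_subset_left (s₁ := u.1) (s₂ := v.1))
    rwa [u.2] at this
  have h1 := h.trans_le (edist_le_of_card_inter hn hd u v)
  have h2 := h.trans_le
    (edist_le_of_card_inter_add hn hd (d - (u.1 ∩ v.1).card) u v (by omega))
  rw [Nat.cast_lt] at h1 h2
  omega

/-- The permutation of the vertices of a Kneser graph that a permutation of the ground set
induces, as a homomorphism. -/
def kneserGraphHom (n d : ℕ) (σ : Equiv.Perm (Fin n)) : kneserGraph n d →g kneserGraph n d where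
  toFun y := ⟨y.1.map σ.toEmbedding, by rw [Finset.card_map, y.2]⟩
  map_rel' := by
    rintro y z ⟨h1, h2⟩
    refine ⟨fun h => h1 (Subtype.ext (Finset.map_injective _ (congrArg Subtype.val h))), ?_⟩
    exact (Finset.disjoint_map _).2 h2

theorem kneserGraphHom_injective (σ : Equiv.Perm (Fin n)) :
    Function.Injective (kneserGraphHom n d σ) := fun _ _ h =>
  Subtype.ext (Finset.map_injective σ.toEmbedding (congrArg Subtype.val h))

open scoped Pointwise in
theorem exists_kneserGraphHom_eq (u v : {s : Finset (Fin n) // s.card = d}) :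
    ∃ σ, kneserGraphHom n d σ u = v := by
  obtain ⟨σ, hσ⟩ := (Set.powersetCard.isPretransitive (α := Fin n) (n := d)).exists_smul_eq
    ⟨u.1, u.2⟩ ⟨v.1, v.2⟩
  refine ⟨σ, Subtype.ext ?_⟩
  have h := congrArg Subtype.val hσ
  rw [Set.powersetCard.coe_smul] at h
  rw [← h]
  ext x
  change x ∈ u.1.map σ.toEmbedding ↔ x ∈ σ • u.1
  rw [Finset.mem_map, Finset.mem_smul_finset]
  rfl

theorem kneserGraph_isPartiallyWalkRegular (n d k : ℕ) :
    IsPartiallyWalkRegular (kneserGraph n d) k := by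
  intro l _ u v
  have hle : ∀ u v, {p : (kneserGraph n d).Walk u u | p.length = l}.ncard
      ≤ {p : (kneserGraph n d).Walk v v | p.length = l}.ncard := by
    intro u v
    obtain ⟨σ, rfl⟩ := exists_kneserGraphHom_eq u v
    refine Set.ncard_le_ncard_of_injOn (fun p => p.map (kneserGraphHom n d σ)) ?_ ?_
      (Set.toFinite _)
    · intro p hp
      simpa using hp
    · exact (SimpleGraph.Walk.map_injective_of_injective
        (kneserGraphHom_injective σ) u u).injOn
  exact le_antisymm (hle u v) (hle v u)

end OddMetric

/-! ### Sets of vertices at maximum mutual distance -/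

section Fisher

/-- Vectors with constant nonnegative mutual inner products and larger squared norms are linearly
independent (the linear-algebra core of Fisher's inequality). -/
theorem linearIndependent_of_dotProduct_eq {ι κ : Type*} [Fintype ι] [Fintype κ]
    (v : ι → κ → ℝ) {b : ℝ} (hb : 0 ≤ b) (hself : ∀ i, b < v i ⬝ᵥ v i)
    (hne : ∀ i j, i ≠ j → v i ⬝ᵥ v j = b) : LinearIndependent ℝ v := by
  classical
  rw [Fintype.linearIndependent_iff]
  intro c hc
  have h1 : ∀ i, c i * (∑ j, c j * (v i ⬝ᵥ v j)) = 0 := by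
    intro i
    have : v i ⬝ᵥ (∑ j, c j • v j) = 0 := by rw [hc, dotProduct_zero]
    rw [dotProduct_sum] at this
    simp only [dotProduct_smul, smul_eq_mul] at this
    rw [this, mul_zero]
  have h2 : ∀ i, ∑ j, c j * (v i ⬝ᵥ v j) = b * ∑ j, c j + c i * (v i ⬝ᵥ v i - b) := by
    intro i
    have h3 : ∀ j, c j * (v i ⬝ᵥ v j)
        = b * c j + if j = i then c i * (v i ⬝ᵥ v i - b) else 0 := by
      intro j
      by_cases hji : j = i
      · subst hji; simp; ring
      · rw [hne i j (Ne.symm hji), if_neg hji]; ring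
    rw [Finset.sum_congr rfl fun j _ => h3 j, Finset.sum_add_distrib, ← Finset.mul_sum]
    simp
  have h4 : b * (∑ j, c j) ^ 2 + ∑ i, c i ^ 2 * (v i ⬝ᵥ v i - b) = 0 := by
    have h5 : ∑ i, c i * (b * ∑ j, c j + c i * (v i ⬝ᵥ v i - b)) = 0 :=
      Finset.sum_eq_zero fun i _ => by rw [← h2, h1]
    rw [← h5]
    simp only [mul_add, Finset.sum_add_distrib]
    rw [← Finset.sum_mul]
    congr 1
    · ring
    · exact Finset.sum_congr rfl fun i _ => by ring
  have h6 : ∀ i ∈ Finset.univ, 0 ≤ c i ^ 2 * (v i ⬝ᵥ v i - b) := fun i _ =>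
    mul_nonneg (sq_nonneg _) (sub_nonneg.2 (hself i).le)
  have h7 : ∑ i, c i ^ 2 * (v i ⬝ᵥ v i - b) = 0 := by
    have := Finset.sum_nonneg h6
    have := mul_nonneg hb (sq_nonneg (∑ j, c j))
    linarith
  intro i
  have h8 := (Finset.sum_eq_zero_iff_of_nonneg h6).1 h7 i (Finset.mem_univ i)
  exact pow_eq_zero_iff two_ne_zero |>.1
    ((mul_eq_zero.1 h8).resolve_right (sub_pos.2 (hself i)).ne')

variable {n d : ℕ}

/-- The indicator vector of a finite set. -/
def indicatorVec (y : Finset (Fin n)) : Fin n → ℝ := fun x => if x ∈ y then 1 else 0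

theorem indicatorVec_dotProduct (y z : Finset (Fin n)) :
    indicatorVec y ⬝ᵥ indicatorVec z = (y ∩ z).card := by
  rw [Finset.inter_comm]
  simp [indicatorVec, dotProduct, ← ite_and, ← Finset.mem_inter]

theorem card_le_of_pairwise_lt_edist (hn : n = 2 * d + 1) (hd : 1 ≤ d)
    (S : Finset {s : Finset (Fin n) // s.card = d})
    (hS : (S : Set _).Pairwise fun u v => ((d - 1 : ℕ) : ℕ∞) < (kneserGraph n d).edist u v) :
    S.card ≤ 2 * d + 1 := by
  have hli : LinearIndependent ℝ (fun y : S => indicatorVec y.1.1) := by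
    refine linearIndependent_of_dotProduct_eq _ (b := (d / 2 : ℕ)) (Nat.cast_nonneg _) ?_ ?_
    · intro y
      rw [indicatorVec_dotProduct, Finset.inter_self, y.1.2, Nat.cast_lt]
      omega
    · intro y z hyz
      rw [indicatorVec_dotProduct, card_inter_of_lt_edist hn hd
        (hS y.2 z.2 fun h => hyz (Subtype.ext h))]
  have h := hli.fintype_card_le_finrank
  rw [Module.finrank_pi, Fintype.card_fin, Fintype.card_coe] at h
  omega

/-- For even `d` the constant vector `1/2` can be added to the indicator vectors of the vertices,
as its inner product with each of them is also `d/2`. -/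
theorem card_le_of_pairwise_lt_edist_of_even (hn : n = 2 * d + 1) (hd : 1 ≤ d) (he : Even d)
    (S : Finset {s : Finset (Fin n) // s.card = d})
    (hS : (S : Set _).Pairwise fun u v => ((d - 1 : ℕ) : ℕ∞) < (kneserGraph n d).edist u v) :
    S.card ≤ 2 * d := by
  obtain ⟨e, rfl⟩ := he
  have hdot : ∀ y : Finset (Fin n), indicatorVec y ⬝ᵥ (fun _ => (1 / 2 : ℝ)) = y.card / 2 := by
    intro y
    simp [indicatorVec, dotProduct, div_eq_mul_inv]
  have hli : LinearIndependent ℝ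
      (fun o : Option S => o.elim (fun _ => (1 / 2 : ℝ)) (fun y => indicatorVec y.1.1)) := by
    refine linearIndependent_of_dotProduct_eq _ (b := e) (Nat.cast_nonneg _) ?_ ?_
    · rintro (_ | y)
      · have : (n : ℝ) = 2 * (e + e) + 1 := by rw [hn]; push_cast; ring
        simp [dotProduct, this]
        linarith
      · simp only [Option.elim]
        rw [indicatorVec_dotProduct, Finset.inter_self, y.1.2, Nat.cast_lt]
        omega
    · rintro (_ | y) (_ | z) hyz
      · exact absurd rfl hyz
      · simp only [Option.elim]
        rw [dotProduct_comm, hdot, z.1.2]; push_cast; ring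
      · simp only [Option.elim]
        rw [hdot, y.1.2]; push_cast; ring
      · simp only [Option.elim]
        rw [indicatorVec_dotProduct, card_inter_of_lt_edist hn hd
          (hS y.2 z.2 fun h => hyz (congrArg some (Subtype.ext h)))]
        congr 1; omega
  have h := hli.fintype_card_le_finrank
  rw [Module.finrank_pi, Fintype.card_fin, Fintype.card_option, Fintype.card_coe] at h
  omega

theorem kIndepNum_le {V : Type*} (G : SimpleGraph V) (k m : ℕ)
    (h : ∀ S : Finset V, (S : Set V).Pairwise (fun u v => (k : ℕ∞) < G.edist u v) → S.card ≤ m) :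
    kIndepNum G k ≤ m := by
  refine csSup_le' ?_
  rintro _ ⟨S, hS, rfl⟩
  exact h S hS

theorem kIndepNum_oddGraph_le (hd : 1 ≤ d) : kIndepNum (oddGraph (d + 1)) (d - 1) ≤ 2 * d + 1 :=
  kIndepNum_le _ _ _ fun S hS =>
    card_le_of_pairwise_lt_edist (n := 2 * (d + 1) - 1) (d := d) rfl hd S hS

theorem kIndepNum_oddGraph_le_of_even (hd : 1 ≤ d) (he : Even d) :
    kIndepNum (oddGraph (d + 1)) (d - 1) ≤ 2 * d :=
  kIndepNum_le _ _ _ fun S hS =>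
    card_le_of_pairwise_lt_edist_of_even (n := 2 * (d + 1) - 1) (d := d) rfl hd he S hS

end Fisher

/-! ### The products `π_i` of eigenvalue differences -/

section EigenvalueProducts

variable {d : ℕ}

theorem oddMu_even (d s : ℕ) : oddMu (d + 1) (2 * s) = (d : ℝ) + 1 - 2 * s := by
  rw [oddMu, (even_two_mul s).neg_one_pow]; push_cast; ring

theorem oddMu_odd (d s : ℕ) : oddMu (d + 1) (2 * s + 1) = 2 * (s : ℝ) - d := by
  rw [oddMu, (odd_two_mul_add_one s).neg_one_pow]; push_cast; ring

theorem oddPi_pos (hd : 1 ≤ d) {i : ℕ} (hi : i ≤ d) : 0 < oddPi (d + 1) i := by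
  rw [oddPi_eq_prod hd hi]
  refine Finset.prod_pos fun j hj => abs_pos.2 (sub_ne_zero.2 fun h => ?_)
  obtain ⟨h1, h2⟩ := Finset.mem_erase.1 hj
  exact h1 (oddMu_injOn hi (Finset.mem_range_succ_iff.1 h2) h).symm

theorem prod_range_two_mul (F : ℕ → ℝ) (m : ℕ) :
    ∏ j ∈ Finset.range (2 * m), F j
      = (∏ s ∈ Finset.range m, F (2 * s)) * ∏ s ∈ Finset.range m, F (2 * s + 1) := by
  induction m with
  | zero => simp
  | succ m ih =>
    rw [show 2 * (m + 1) = 2 * m + 1 + 1 by ring, Finset.prod_range_succ, Finset.prod_range_succ,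
      ih, Finset.prod_range_succ, Finset.prod_range_succ]
    ring

theorem prod_range_split_parity (F : ℕ → ℝ) {e f : ℕ} (hf : f = e ∨ f = e + 1) :
    ∏ j ∈ Finset.range (e + f + 1), F j
      = (∏ s ∈ Finset.range (e + 1), F (2 * s)) * ∏ s ∈ Finset.range f, F (2 * s + 1) := by
  rcases hf with rfl | rfl
  · rw [show f + f + 1 = 2 * f + 1 by ring, Finset.prod_range_succ, prod_range_two_mul,
      Finset.prod_range_succ (fun s => F (2 * s))]
    ring
  · rw [show e + (e + 1) + 1 = 2 * (e + 1) by ring, prod_range_two_mul]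

theorem oddPi_eq_prod_ite (hd : 1 ≤ d) {i : ℕ} (hi : i ≤ d) :
    oddPi (d + 1) i = ∏ j ∈ Finset.range (d + 1),
      if j = i then 1 else |oddMu (d + 1) i - oddMu (d + 1) j| := by
  rw [oddPi_eq_prod hd hi,
    ← Finset.mul_prod_erase _ _ (Finset.mem_range.2 (Nat.lt_succ_iff.2 hi)), if_pos rfl, one_mul]
  exact Finset.prod_congr rfl fun j hj => (if_neg (Finset.ne_of_mem_erase hj)).symm

theorem prod_two_mul_abs_sub {e t : ℕ} (ht : t ≤ e) :
    (∏ s ∈ Finset.range (e + 1), if s = t then (1 : ℝ) else |2 * (s : ℝ) - 2 * t|)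
      = 2 ^ e * (t.factorial * (e - t).factorial) := by
  induction e, ht using Nat.le_induction with
  | base =>
    rw [Finset.prod_range_succ, if_pos rfl, mul_one, Nat.sub_self, Nat.factorial_zero,
      Nat.cast_one, mul_one]
    have h : ∀ t : ℕ, ∏ s ∈ Finset.range t, (2 * (t : ℝ) - 2 * s) = 2 ^ t * t.factorial := by
      intro t
      induction t with
      | zero => simp
      | succ t ih =>
        rw [Finset.prod_range_succ', Nat.factorial_succ]
        have h1 : ∀ s ∈ Finset.range t, 2 * ((t + 1 : ℕ) : ℝ) - 2 * ((s + 1 : ℕ) : ℝ)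
            = 2 * (t : ℝ) - 2 * s := fun s _ => by push_cast; ring
        rw [Finset.prod_congr rfl h1, ih]
        push_cast; ring
    rw [← h]
    refine Finset.prod_congr rfl fun s hs => ?_
    have hs : s < t := Finset.mem_range.1 hs
    have hs' : (s : ℝ) < t := by exact_mod_cast hs
    rw [if_neg hs.ne, abs_of_neg (by linarith)]
    ring
  | succ e ht ih =>
    have hs' : (t : ℝ) ≤ e := by exact_mod_cast ht
    rw [Finset.prod_range_succ, ih, if_neg (by omega), Nat.succ_sub ht, Nat.factorial_succ,
      abs_of_pos (by push_cast; linarith)]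
    push_cast [Nat.cast_sub ht]
    ring

/-- The factors of `π_{2t}` that come from the eigenvalues of even index form a product of
factorials, the other ones an arithmetic progression of step `2`. -/
theorem oddPi_even {e f t : ℕ} (hf : f = e ∨ f = e + 1) (hd : 1 ≤ e + f) (ht : t ≤ e) :
    oddPi (e + f + 1) (2 * t)
      = 2 ^ e * (t.factorial * (e - t).factorial)
        * ∏ s ∈ Finset.range f, (2 * ((e : ℝ) + f) + 1 - 2 * t - 2 * s) := by
  rw [oddPi_eq_prod_ite hd (by omega), prod_range_split_parity _ hf, ← prod_two_mul_abs_sub ht]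
  congr 1
  · refine Finset.prod_congr rfl fun s _ => ?_
    by_cases h : s = t
    · simp [h]
    · rw [if_neg h, if_neg (by omega), oddMu_even, oddMu_even]
      congr 1; ring
  · refine Finset.prod_congr rfl fun s hs => ?_
    have h1 : ((s + 1 : ℕ) : ℝ) ≤ f := by exact_mod_cast Finset.mem_range.1 hs
    have h2 : (t : ℝ) ≤ e := by exact_mod_cast ht
    have h3 : ((f : ℕ) : ℝ) ≤ (e + 1 : ℕ) := by exact_mod_cast (by omega : f ≤ e + 1)
    have h4 : ((e : ℕ) : ℝ) ≤ f := by exact_mod_cast (by omega : e ≤ f)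
    push_cast at h1 h3
    rw [if_neg (by omega), oddMu_even, oddMu_odd, abs_of_nonneg (by push_cast; linarith)]
    push_cast; ring

theorem oddPi_even_succ {e f t : ℕ} (hf : f = e ∨ f = e + 1) (hd : 1 ≤ e + f) (ht : t + 1 ≤ e) :
    oddPi (e + f + 1) (2 * (t + 1)) * (((e : ℝ) - t) * (2 * ((e : ℝ) + f) + 1 - 2 * t))
      = oddPi (e + f + 1) (2 * t) * (((t : ℝ) + 1) * (2 * (e : ℝ) + 1 - 2 * t)) := by
  have h1 : (∏ s ∈ Finset.range f, (2 * ((e : ℝ) + f) + 1 - 2 * (t + 1 : ℕ) - 2 * s))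
        * (2 * ((e : ℝ) + f) + 1 - 2 * t)
      = (∏ s ∈ Finset.range f, (2 * ((e : ℝ) + f) + 1 - 2 * t - 2 * s))
        * (2 * (e : ℝ) + 1 - 2 * t) := by
    have h2 := Finset.prod_range_succ (fun s : ℕ => 2 * ((e : ℝ) + f) + 1 - 2 * t - 2 * (s : ℝ)) f
    rw [Finset.prod_range_succ'] at h2
    have h3 : ∀ s ∈ Finset.range f, 2 * ((e : ℝ) + f) + 1 - 2 * t - 2 * ((s + 1 : ℕ) : ℝ)
        = 2 * ((e : ℝ) + f) + 1 - 2 * (t + 1 : ℕ) - 2 * s := fun s _ => by push_cast; ring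
    rw [Finset.prod_congr rfl h3] at h2
    push_cast at h2 ⊢
    linear_combination h2
  have h4 : ((e - t).factorial : ℝ) = ((e : ℝ) - t) * (e - (t + 1)).factorial := by
    rw [show e - t = (e - (t + 1)) + 1 by omega, Nat.factorial_succ]
    push_cast [Nat.cast_sub ht]
    ring
  rw [oddPi_even hf hd ht, oddPi_even hf hd (by omega), Nat.factorial_succ, h4]
  push_cast at h1 ⊢
  linear_combination (2 ^ e * (((t : ℝ) + 1) * t.factorial * (e - (t + 1)).factorial)
    * ((e : ℝ) - t)) * h1

/-- For odd `d` the spectrum is invariant under `x ↦ 1 - x`, which exchanges `μ_{2t}` and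
`μ_{2t+1}`. -/
theorem oddPi_odd {e t : ℕ} (ht : t ≤ e) :
    oddPi (e + (e + 1) + 1) (2 * t + 1) = oddPi (e + (e + 1) + 1) (2 * t) := by
  rw [oddPi_eq_prod_ite (by omega) (by omega), oddPi_eq_prod_ite (by omega) (by omega),
    prod_range_split_parity _ (Or.inr rfl), prod_range_split_parity _ (Or.inr rfl), mul_comm]
  congr 1
  · refine Finset.prod_congr rfl fun s _ => ?_
    by_cases h : s = t
    · simp [h]
    · rw [if_neg (by omega), if_neg (by omega), oddMu_even, oddMu_odd, oddMu_even, oddMu_odd,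
        ← abs_neg]
      congr 1; ring
  · refine Finset.prod_congr rfl fun s _ => ?_
    rw [if_neg (by omega), if_neg (by omega), oddMu_even, oddMu_odd, oddMu_even, oddMu_odd,
      ← abs_neg]
    congr 1; push_cast; ring

end EigenvalueProducts

/-! ### The multiplicities `m_i` -/

section Multiplicities

variable {d : ℕ}

theorem oddMult_succ_mul (hd : 1 ≤ d) {i : ℕ} (hi : i + 1 ≤ d) :
    oddMult (d + 1) (i + 1) * (i + 1) = (2 * d + 1).choose i * (2 * ((d : ℝ) - i)) := by
  have h := congrArg (Nat.cast : ℕ → ℝ) (Nat.choose_succ_right_eq (2 * d + 1) i)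
  push_cast [Nat.cast_sub (by omega : i ≤ 2 * d + 1)] at h
  rw [oddMult_succ hd hi]
  linear_combination h

theorem oddMult_mul (hd : 1 ≤ d) {i : ℕ} (hi : i ≤ d) :
    oddMult (d + 1) i * (2 * (d : ℝ) + 2 - i) = (2 * d + 1).choose i * (2 * ((d : ℝ) + 1 - i)) := by
  rcases Nat.eq_zero_or_pos i with rfl | h0
  · rw [oddMult_zero hd]; simp; ring
  · obtain ⟨k, rfl⟩ : ∃ k, i = k + 1 := ⟨i - 1, by omega⟩
    have h := congrArg (Nat.cast : ℕ → ℝ) (Nat.choose_succ_right_eq (2 * d + 1) k)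
    push_cast [Nat.cast_sub (by omega : k ≤ 2 * d + 1)] at h
    have h1 := oddMult_succ_mul hd hi
    have h2 : (k : ℝ) + 1 ≠ 0 := by positivity
    apply mul_right_cancel₀ h2
    push_cast
    linear_combination (2 * (d : ℝ) + 1 - k) * h1 - 2 * ((d : ℝ) - k) * h

theorem oddMult_succ_mul_eq (hd : 1 ≤ d) {i : ℕ} (hi : i + 1 ≤ d) :
    oddMult (d + 1) (i + 1) * ((i + 1) * ((d : ℝ) + 1 - i))
      = oddMult (d + 1) i * ((2 * (d : ℝ) + 2 - i) * ((d : ℝ) - i)) := by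
  linear_combination ((d : ℝ) + 1 - i) * oddMult_succ_mul hd hi
    - ((d : ℝ) - i) * oddMult_mul hd (by omega : i ≤ d)

theorem oddMult_one (hd : 1 ≤ d) : oddMult (d + 1) 1 = 2 * d := by
  rw [oddMult_succ hd hd]; simp

theorem oddMult_two (hd : 2 ≤ d) : oddMult (d + 1) 2 = (2 * (d : ℝ) + 1) * (d - 1) := by
  have h := oddMult_succ_mul_eq (by omega : 1 ≤ d) hd
  rw [oddMult_one (by omega)] at h
  push_cast at h
  have h1 : (2 : ℝ) ≤ d := by exact_mod_cast hd
  have h2 : (2 : ℝ) * d ≠ 0 := by positivity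
  apply mul_right_cancel₀ h2
  linear_combination h

theorem le_oddMult {i : ℕ} (h2 : 2 ≤ i) (hi : i ≤ d) : 2 * (d : ℝ) + 1 ≤ oddMult (d + 1) i := by
  have h := oddMult_mul (by omega : 1 ≤ d) hi
  have hc : (2 * d + 1) * d ≤ (2 * d + 1).choose i := by
    have h3 : (2 * d + 1).choose 2 = (2 * d + 1) * d := by
      rw [Nat.choose_two_right]
      exact Nat.div_eq_of_eq_mul_left two_pos (by simp; ring)
    rw [← h3]
    clear h
    induction i, h2 using Nat.le_induction with
    | base => exact le_rfl
    | succ i h2 ih =>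
      exact (ih (by omega)).trans (Nat.choose_le_succ_of_lt_half_left (by omega))
  have hc' : (2 * (d : ℝ) + 1) * d ≤ (2 * d + 1).choose i := by exact_mod_cast hc
  have hi' : (i : ℝ) ≤ d := by exact_mod_cast hi
  have h2' : (2 : ℝ) ≤ i := by exact_mod_cast h2
  have hm : (0 : ℝ) ≤ oddMult (d + 1) i := Nat.cast_nonneg _
  have h4 : oddMult (d + 1) i * (2 * d) ≥ (2 * (d : ℝ) + 1) * (2 * d) := by
    calc oddMult (d + 1) i * (2 * d) ≥ oddMult (d + 1) i * (2 * (d : ℝ) + 2 - i) :=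
          mul_le_mul_of_nonneg_left (by linarith) hm
      _ = (2 * d + 1).choose i * (2 * ((d : ℝ) + 1 - i)) := h
      _ ≥ (2 * d + 1).choose i * 2 := mul_le_mul_of_nonneg_left (by linarith) (Nat.cast_nonneg _)
      _ ≥ (2 * (d : ℝ) + 1) * (2 * d) := by linarith
  exact le_of_mul_le_mul_right h4 (by linarith)

end Multiplicities

/-! ### Lower bounds for `m_i π_i` when `d` is odd -/

section MultPi

/-- A sequence that keeps decreasing once it decreases is bounded below by its end values. -/
theorem le_of_unimodal {U : ℕ → ℝ} {e : ℕ} {c : ℝ} (h0 : c ≤ U 0) (he : c ≤ U e)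
    (h : ∀ t, t + 1 < e → U (t + 1) < U t → U (t + 2) < U (t + 1)) : ∀ t ≤ e, c ≤ U t := by
  have hdec : ∀ t, t + 1 ≤ e → U (t + 1) < U t → ∀ s, t + 1 ≤ s → s ≤ e → U s ≤ U (t + 1) := by
    intro t _ hlt s hs
    suffices H : s ≤ e → U s ≤ U (t + 1) ∧ U s < U (s - 1) from fun hse => (H hse).1
    induction s, hs using Nat.le_induction with
    | base => exact fun _ => ⟨le_rfl, hlt⟩
    | succ s hs ih =>
      intro hse
      obtain ⟨h1, h2⟩ := ih (by omega)
      have h3 := h (s - 1) (by omega)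
      rw [show s - 1 + 1 = s by omega, show s - 1 + 2 = s + 1 by omega] at h3
      exact ⟨(h3 h2).le.trans h1, h3 h2⟩
  intro t
  induction t with
  | zero => exact fun _ => h0
  | succ t ih =>
    intro ht
    by_contra! hlt
    exact absurd (he.trans (hdec t ht (hlt.trans_le (ih (by omega))) e ht le_rfl)) (not_le.2 hlt)

theorem oddMult_mul_oddPi_even_succ {e t : ℕ} (ht : t + 1 ≤ e) :
    oddMult (e + (e + 1) + 1) (2 * (t + 1)) * oddPi (e + (e + 1) + 1) (2 * (t + 1))
      = oddMult (e + (e + 1) + 1) (2 * t + 1) * oddPi (e + (e + 1) + 1) (2 * t + 1) := by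
  have h1 := oddMult_succ_mul_eq (d := e + (e + 1)) (i := 2 * t + 1) (by omega) (by omega)
  have h2 := oddPi_even_succ (e := e) (f := e + 1) (t := t) (Or.inr rfl) (by omega) ht
  rw [oddPi_odd (by omega)]
  have ht' : (t : ℝ) + 1 ≤ e := by exact_mod_cast ht
  have ht0 : (0 : ℝ) ≤ t := t.cast_nonneg
  have h3 : (2 * (t : ℝ) + 2) * (2 * (e : ℝ) + 1 - 2 * t)
      * ((e - t) * (4 * (e : ℝ) + 3 - 2 * t)) ≠ 0 := by
    have a1 : 0 < 2 * (t : ℝ) + 2 := by linarith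
    have a2 : 0 < 2 * (e : ℝ) + 1 - 2 * t := by linarith
    have a3 : 0 < (e : ℝ) - t := by linarith
    have a4 : 0 < 4 * (e : ℝ) + 3 - 2 * t := by linarith
    positivity
  apply mul_right_cancel₀ h3
  rw [show 2 * t + 1 + 1 = 2 * (t + 1) by ring] at h1
  push_cast at h1 h2 ⊢
  linear_combination oddPi (e + (e + 1) + 1) (2 * (t + 1)) * ((e - t) * (4 * (e : ℝ) + 3 - 2 * t))
      * h1 + 2 * oddMult (e + (e + 1) + 1) (2 * t + 1) * ((e : ℝ) - t)
      * (4 * (e : ℝ) + 3 - 2 * t) * h2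

theorem oddMult_mul_oddPi_odd_succ {e t : ℕ} (ht : t + 1 ≤ e) :
    oddMult (e + (e + 1) + 1) (2 * (t + 1) + 1) * oddPi (e + (e + 1) + 1) (2 * (t + 1) + 1)
        * ((2 * (t : ℝ) + 3) * (e - t))
      = oddMult (e + (e + 1) + 1) (2 * t + 1) * oddPi (e + (e + 1) + 1) (2 * t + 1)
        * ((2 * (e : ℝ) + 1 - t) * (2 * (e : ℝ) - 1 - 2 * t)) := by
  have h1 := oddMult_succ_mul_eq (d := e + (e + 1)) (i := 2 * (t + 1)) (by omega) (by omega)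
  rw [← oddMult_mul_oddPi_even_succ ht, oddPi_odd ht]
  push_cast at h1 ⊢
  linear_combination oddPi (e + (e + 1) + 1) (2 * (t + 1)) / 2 * h1

/-- The closed form of `m_{2t+1} π_{2t+1}` relative to `m_1 π_1`, with denominators cleared. -/
theorem oddMult_mul_oddPi_odd {e t : ℕ} (ht : t ≤ e) :
    oddMult (e + (e + 1) + 1) (2 * t + 1) * oddPi (e + (e + 1) + 1) (2 * t + 1)
        * ((∏ s ∈ Finset.range t, (2 * (s : ℝ) + 3)) * e.choose t)
      = oddMult (e + (e + 1) + 1) 1 * oddPi (e + (e + 1) + 1) 1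
        * ((∏ s ∈ Finset.range t, (2 * (e : ℝ) - 1 - 2 * s)) * (2 * e + 1).choose t) := by
  induction t with
  | zero => simp
  | succ t ih =>
    have h1 := ih (by omega)
    have h2 := oddMult_mul_oddPi_odd_succ ht
    have h3 := congrArg (Nat.cast : ℕ → ℝ) (Nat.choose_succ_right_eq e t)
    have h4 := congrArg (Nat.cast : ℕ → ℝ) (Nat.choose_succ_right_eq (2 * e + 1) t)
    push_cast [Nat.cast_sub (by omega : t ≤ e), Nat.cast_sub (by omega : t ≤ 2 * e + 1)] at h3 h4
    rw [Finset.prod_range_succ, Finset.prod_range_succ]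
    have h5 : (t : ℝ) + 1 ≠ 0 := by positivity
    apply mul_right_cancel₀ h5
    set a := oddMult (e + (e + 1) + 1) (2 * (t + 1) + 1) * oddPi (e + (e + 1) + 1) (2 * (t + 1) + 1)
    set b := oddMult (e + (e + 1) + 1) (2 * t + 1) * oddPi (e + (e + 1) + 1) (2 * t + 1)
    set c := oddMult (e + (e + 1) + 1) 1 * oddPi (e + (e + 1) + 1) 1
    set p := ∏ s ∈ Finset.range t, (2 * (s : ℝ) + 3)
    set q := ∏ s ∈ Finset.range t, (2 * (e : ℝ) - 1 - 2 * s)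
    linear_combination a * p * (2 * (t : ℝ) + 3) * h3 + p * (e.choose t : ℝ) * h2
      + (2 * (e : ℝ) + 1 - t) * (2 * (e : ℝ) - 1 - 2 * t) * h1
      - c * q * (2 * (e : ℝ) - 1 - 2 * t) * h4

theorem oddMult_mul_oddPi_last (e : ℕ) :
    oddMult (e + (e + 1) + 1) 1 * oddPi (e + (e + 1) + 1) 1
      ≤ oddMult (e + (e + 1) + 1) (2 * e + 1) * oddPi (e + (e + 1) + 1) (2 * e + 1) := by
  have h := oddMult_mul_oddPi_odd (le_refl e)
  have hq : ∏ s ∈ Finset.range e, (2 * (e : ℝ) - 1 - 2 * s)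
      = ∏ s ∈ Finset.range e, (2 * (s : ℝ) + 1) := by
    rw [← Finset.prod_range_reflect]
    refine Finset.prod_congr rfl fun s hs => ?_
    have hs := Finset.mem_range.1 hs
    push_cast [Nat.cast_sub (by omega : s ≤ e - 1), Nat.cast_sub (by omega : 1 ≤ e)]
    ring
  have hp : ∏ s ∈ Finset.range e, (2 * (s : ℝ) + 3)
      = (∏ s ∈ Finset.range e, (2 * (s : ℝ) + 1)) * (2 * e + 1) := by
    rw [← Finset.prod_range_succ (fun s : ℕ => 2 * (s : ℝ) + 1), Finset.prod_range_succ']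
    simp only [Nat.cast_zero, mul_zero, zero_add, mul_one]
    exact Finset.prod_congr rfl fun s _ => by push_cast; ring
  have hpos : 0 < ∏ s ∈ Finset.range e, (2 * (s : ℝ) + 1) :=
    Finset.prod_pos fun s _ => by positivity
  have hc : 2 * e + 1 ≤ (2 * e + 1).choose e := by
    have h1 := Nat.choose_le_middle 1 (2 * e + 1)
    rwa [Nat.choose_one_right, show (2 * e + 1) / 2 = e by omega] at h1
  have hc' : 2 * (e : ℝ) + 1 ≤ (2 * e + 1).choose e := by exact_mod_cast hc
  rw [hp, hq, Nat.choose_self, Nat.cast_one, mul_one] at h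
  set q := ∏ s ∈ Finset.range e, (2 * (s : ℝ) + 1)
  have hm : 0 ≤ oddMult (e + (e + 1) + 1) 1 * oddPi (e + (e + 1) + 1) 1 :=
    mul_nonneg (Nat.cast_nonneg _) (oddPi_pos (by omega) (by omega)).le
  have h5 : oddMult (e + (e + 1) + 1) 1 * oddPi (e + (e + 1) + 1) 1 * (2 * (e : ℝ) + 1)
      ≤ oddMult (e + (e + 1) + 1) (2 * e + 1) * oddPi (e + (e + 1) + 1) (2 * e + 1)
        * (2 * (e : ℝ) + 1) := by
    refine (mul_le_mul_of_nonneg_left hc' hm).trans_eq ?_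
    apply mul_right_cancel₀ hpos.ne'
    linear_combination -h
  exact le_of_mul_le_mul_right h5 (by positivity)

/-- The product `m_i π_i`, `i ≥ 1`, is smallest at `i = 1`. -/
theorem le_oddMult_mul_oddPi {e i : ℕ} (h1 : 1 ≤ i) (hi : i ≤ e + (e + 1)) :
    oddMult (e + (e + 1) + 1) 1 * oddPi (e + (e + 1) + 1) 1
      ≤ oddMult (e + (e + 1) + 1) i * oddPi (e + (e + 1) + 1) i := by
  set U : ℕ → ℝ := fun t =>
    oddMult (e + (e + 1) + 1) (2 * t + 1) * oddPi (e + (e + 1) + 1) (2 * t + 1) with hU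
  have hpos : ∀ t ≤ e, 0 ≤ U t := fun t ht =>
    mul_nonneg (Nat.cast_nonneg _) (oddPi_pos (by omega) (by omega)).le
  have hodd : ∀ t ≤ e, oddMult (e + (e + 1) + 1) 1 * oddPi (e + (e + 1) + 1) 1 ≤ U t := by
    refine le_of_unimodal (e := e) le_rfl (oddMult_mul_oddPi_last e) ?_
    intro t ht hlt
    have r1 : U (t + 1) * ((2 * (t : ℝ) + 3) * (e - t))
        = U t * ((2 * (e : ℝ) + 1 - t) * (2 * (e : ℝ) - 1 - 2 * t)) :=
      oddMult_mul_oddPi_odd_succ (by omega)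
    have r2 : U (t + 2) * ((2 * ((t + 1 : ℕ) : ℝ) + 3) * (e - (t + 1 : ℕ)))
        = U (t + 1) * ((2 * (e : ℝ) + 1 - (t + 1 : ℕ)) * (2 * (e : ℝ) - 1 - 2 * (t + 1 : ℕ))) :=
      oddMult_mul_oddPi_odd_succ (by omega)
    push_cast at r2
    have ht' : (t : ℝ) + 2 ≤ e := by exact_mod_cast (by omega : t + 2 ≤ e)
    have ht0 : (0 : ℝ) ≤ t := t.cast_nonneg
    have p1 : 0 < (2 * (t : ℝ) + 3) * (e - t) := mul_pos (by linarith) (by linarith)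
    have p2 : 0 < (2 * ((t : ℝ) + 1) + 3) * (e - (t + 1)) := mul_pos (by linarith) (by linarith)
    have hUt : 0 < U t := lt_of_le_of_lt (hpos (t + 1) (by omega)) hlt
    have hUt1 : 0 < U (t + 1) := by
      have p3 : 0 < (2 * (e : ℝ) + 1 - t) * (2 * (e : ℝ) - 1 - 2 * t) :=
        mul_pos (by linarith) (by linarith)
      have := mul_pos hUt p3
      rw [← r1] at this
      exact (pos_iff_pos_of_mul_pos this).2 p1
    have q1 : (2 * (e : ℝ) + 1 - t) * (2 * (e : ℝ) - 1 - 2 * t) < (2 * (t : ℝ) + 3) * (e - t) := by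
      have := mul_lt_mul_of_pos_right hlt p1
      rw [r1] at this
      exact lt_of_mul_lt_mul_left this hUt.le
    have q2 : (2 * (e : ℝ) + 1 - (t + 1)) * (2 * (e : ℝ) - 1 - 2 * (t + 1))
        < (2 * ((t : ℝ) + 1) + 3) * (e - (t + 1)) := by
      -- With `a = e - t`, the difference of the sides of `q1` is `4a² - 2a - e - 1`,
      -- which increases with `a`.
      nlinarith
    have := mul_lt_mul_of_pos_left q2 hUt1
    rw [← r2] at this
    exact lt_of_mul_lt_mul_right this p2.le
  rcases Nat.even_or_odd' i with ⟨t, rfl | rfl⟩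
  · obtain ⟨s, rfl⟩ : ∃ s, t = s + 1 := ⟨t - 1, by omega⟩
    rw [oddMult_mul_oddPi_even_succ (by omega)]
    exact hodd s (by omega)
  · exact hodd t (by omega)

end MultPi

/-! ### Divided differences on the spectrum -/

section DividedDifference

open Polynomial

variable {d : ℕ}

/-- The coefficient of `g(μ_i)` in the divided difference of `g` at `μ_0, …, μ_d`. -/
noncomputable def oddWeight (d i : ℕ) : ℝ :=
  (∏ j ∈ (Finset.range (d + 1)).erase i, (oddMu (d + 1) i - oddMu (d + 1) j))⁻¹

theorem oddMu_injOn_range (d : ℕ) :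
    Set.InjOn (oddMu (d + 1)) (Finset.range (d + 1) : Set ℕ) := by
  intro i hi j hj h
  simp only [Finset.coe_range, Set.mem_Iio] at hi hj
  exact oddMu_injOn (Nat.lt_succ_iff.1 hi) (Nat.lt_succ_iff.1 hj) h

/-- The divided difference of order `d` annihilates the polynomials of degree less than `d`. -/
theorem sum_eval_mul_oddWeight (hd : 1 ≤ d) {g : ℝ[X]} (hg : g.natDegree ≤ d - 1) :
    ∑ i ∈ Finset.range (d + 1), oddWeight d i * g.eval (oddMu (d + 1) i) = 0 := by
  have hlt : g.natDegree < d := by omega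
  have h := Lagrange.coeff_eq_sum (s := Finset.range (d + 1)) (v := oddMu (d + 1))
    (oddMu_injOn_range d) (P := g) (by
      rw [Finset.card_range]
      exact degree_le_natDegree.trans_lt (by exact_mod_cast (by omega : g.natDegree < d + 1)))
  rw [Finset.card_range, Nat.add_sub_cancel, coeff_eq_zero_of_natDegree_lt hlt] at h
  rw [h]
  exact Finset.sum_congr rfl fun i _ => by rw [oddWeight, div_eq_mul_inv, mul_comm]

theorem abs_oddWeight (hd : 1 ≤ d) {i : ℕ} (hi : i ≤ d) :
    |oddWeight d i| = (oddPi (d + 1) i)⁻¹ := by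
  rw [oddWeight, abs_inv, Finset.abs_prod, oddPi_eq_prod hd hi]

theorem oddWeight_zero (hd : 1 ≤ d) : oddWeight d 0 = (oddPi (d + 1) 0)⁻¹ := by
  rw [← abs_oddWeight hd (Nat.zero_le d), abs_of_nonneg]
  refine inv_nonneg.2 (Finset.prod_nonneg fun j hj => ?_)
  have hj' : (j : ℝ) ≤ d := by
    exact_mod_cast Finset.mem_range_succ_iff.1 (Finset.mem_of_mem_erase hj)
  have h0 : (0 : ℝ) ≤ j := j.cast_nonneg
  rcases neg_one_pow_eq_or ℝ j with h | h <;> simp only [oddMu, h] <;> push_cast <;> linarith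

/-- For odd `d`, as `μ_1` is the smallest eigenvalue, its coefficient is negative. -/
theorem oddWeight_one (ho : Odd d) : oddWeight d 1 = -(oddPi (d + 1) 1)⁻¹ := by
  have hd : 1 ≤ d := ho.pos
  rw [oddWeight, oddPi_eq_prod hd hd, ← inv_neg]
  congr 1
  have h1 : ∀ j ∈ (Finset.range (d + 1)).erase 1,
      oddMu (d + 1) 1 - oddMu (d + 1) j = -|oddMu (d + 1) 1 - oddMu (d + 1) j| := by
    intro j hj
    obtain ⟨hj1, hj2⟩ := Finset.mem_erase.1 hj
    have hj' : (j : ℝ) ≤ d := by exact_mod_cast Finset.mem_range_succ_iff.1 hj2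
    have h0 : (0 : ℝ) ≤ j := j.cast_nonneg
    rw [abs_of_nonpos, neg_neg]
    rcases Nat.even_or_odd j with ej | oj
    · simp only [oddMu, ej.neg_one_pow]; push_cast; linarith
    · have : (1 : ℝ) ≤ j := by exact_mod_cast oj.pos
      simp only [oddMu, oj.neg_one_pow]; push_cast; linarith
  rw [Finset.prod_congr rfl h1, Finset.prod_neg, Finset.card_erase_of_mem (by simp; omega),
    Finset.card_range, Nat.add_sub_cancel, ho.neg_one_pow, neg_one_mul]

/-- Any multiple of the divided difference can be added to the trace of a polynomial of degree
less than `d` in the adjacency matrix. -/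
theorem sum_oddMult_add_mul_oddWeight (hd : 1 ≤ d) (c : ℝ) {g : ℝ[X]} (hg : g.natDegree ≤ d - 1) :
    ∑ i ∈ Finset.range (d + 1), (oddMult (d + 1) i + c * oddWeight d i) * g.eval (oddMu (d + 1) i)
      = ∑ i ∈ Finset.range (d + 1), oddMult (d + 1) i * g.eval (oddMu (d + 1) i) := by
  have h := sum_eval_mul_oddWeight hd hg
  simp only [add_mul, mul_assoc, Finset.sum_add_distrib, ← Finset.mul_sum]
  rw [h, mul_zero, add_zero]

theorem oddPi_one (ho : Odd d) : oddPi (d + 1) 1 = oddPi (d + 1) 0 := by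
  obtain ⟨e, rfl⟩ := ho
  rw [show 2 * e + 1 = e + (e + 1) by ring]
  exact oddPi_odd (Nat.zero_le e)

theorem two_mul_oddPi_le (ho : Odd d) {i : ℕ} (h1 : 1 ≤ i) (hi : i ≤ d) :
    2 * d * oddPi (d + 1) 0 ≤ oddMult (d + 1) i * oddPi (d + 1) i := by
  rw [← oddPi_one ho, ← oddMult_one ho.pos]
  obtain ⟨e, rfl⟩ := ho
  rw [show 2 * e + 1 = e + (e + 1) by ring] at hi ⊢
  exact le_oddMult_mul_oddPi h1 hi

theorem oddMult_add_nonneg (ho : Odd d) {i : ℕ} (h1 : 1 ≤ i) (hi : i ≤ d) :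
    0 ≤ oddMult (d + 1) i + 2 * d * oddPi (d + 1) 0 * oddWeight d i := by
  have hp := oddPi_pos ho.pos hi
  have hp0 := oddPi_pos ho.pos (Nat.zero_le d)
  have h2 := neg_abs_le (oddWeight d i)
  rw [abs_oddWeight ho.pos hi] at h2
  have h3 : 2 * d * oddPi (d + 1) 0 * (oddPi (d + 1) i)⁻¹ ≤ oddMult (d + 1) i := by
    rw [← div_eq_mul_inv, div_le_iff₀ hp]
    exact two_mul_oddPi_le ho h1 hi
  have h4 : 0 ≤ 2 * d * oddPi (d + 1) 0 := by positivity
  nlinarith [mul_le_mul_of_nonneg_left h2 h4]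

theorem oddMult_sub_pos (ho : Odd d) {i : ℕ} (h1 : 1 ≤ i) (hi : i ≤ d) :
    0 < oddMult (d + 1) i + -oddPi (d + 1) 0 * oddWeight d i := by
  have hp := oddPi_pos ho.pos hi
  have hp0 := oddPi_pos ho.pos (Nat.zero_le d)
  have h2 := le_abs_self (oddWeight d i)
  rw [abs_oddWeight ho.pos hi] at h2
  have hd : (1 : ℝ) ≤ d := by exact_mod_cast ho.pos
  have h3 : oddPi (d + 1) 0 * (oddPi (d + 1) i)⁻¹ < oddMult (d + 1) i := by
    rw [← div_eq_mul_inv, div_lt_iff₀ hp]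
    refine lt_of_lt_of_le ?_ (two_mul_oddPi_le ho h1 hi)
    nlinarith
  nlinarith [mul_le_mul_of_nonneg_left h2 hp0.le]

theorem oddMult_zero_add (hd : 1 ≤ d) (c : ℝ) :
    oddMult (d + 1) 0 + c * oddPi (d + 1) 0 * oddWeight d 0 = 1 + c := by
  rw [oddMult_zero hd, oddWeight_zero hd, mul_assoc,
    mul_inv_cancel₀ (oddPi_pos hd (Nat.zero_le d)).ne', mul_one]

theorem oddMult_one_add (ho : Odd d) :
    oddMult (d + 1) 1 + 2 * d * oddPi (d + 1) 0 * oddWeight d 1 = 0 := by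
  rw [oddMult_one ho.pos, oddWeight_one ho, oddPi_one ho, mul_neg, mul_assoc,
    mul_inv_cancel₀ (oddPi_pos ho.pos (Nat.zero_le d)).ne', mul_one, add_neg_cancel]

end DividedDifference

/-! ### The minor polynomial and the sign polynomial -/

section CvetkovicHoffman

open Polynomial

variable {d : ℕ}

/-- The polynomial of degree `d - 1` with value `1` at `μ_0` that vanishes at all other
eigenvalues of the Odd graph except `μ_1`. -/
noncomputable def oddMinorPoly (d : ℕ) : ℝ[X] :=
  Lagrange.basis ((Finset.range (d + 1)).erase 1) (oddMu (d + 1)) 0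

theorem natDegree_oddMinorPoly (hd : 1 ≤ d) : (oddMinorPoly d).natDegree = d - 1 := by
  rw [oddMinorPoly, Lagrange.natDegree_basis
    ((oddMu_injOn_range d).mono (by simp)) (by simp),
    Finset.card_erase_of_mem (by simp; omega), Finset.card_range, Nat.add_sub_cancel]

theorem eval_oddMinorPoly_zero (d : ℕ) : (oddMinorPoly d).eval (oddMu (d + 1) 0) = 1 :=
  Lagrange.eval_basis_self ((oddMu_injOn_range d).mono (by simp)) (by simp)

theorem eval_oddMinorPoly_of_two_le {i : ℕ} (h2 : 2 ≤ i) (hi : i ≤ d) :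
    (oddMinorPoly d).eval (oddMu (d + 1) i) = 0 :=
  Lagrange.eval_basis_of_ne (by omega) (by simp; omega)

/-- Sums over the indices `0, …, d`, with the first two terms separated. -/
theorem sum_range_eq_add_add (hd : 1 ≤ d) (F : ℕ → ℝ) :
    ∑ i ∈ Finset.range (d + 1), F i = F 0 + F 1 + ∑ i ∈ Finset.Ico 2 (d + 1), F i := by
  rw [Finset.range_eq_Ico, Finset.sum_eq_sum_Ico_succ_bot (by omega),
    Finset.sum_eq_sum_Ico_succ_bot (by omega), ← add_assoc]

theorem eval_oddMinorPoly_one (ho : Odd d) : (oddMinorPoly d).eval (oddMu (d + 1) 1) = 1 := by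
  have h := sum_eval_mul_oddWeight ho.pos (natDegree_oddMinorPoly ho.pos).le
  rw [sum_range_eq_add_add ho.pos, Finset.sum_eq_zero, eval_oddMinorPoly_zero,
    oddWeight_zero ho.pos, oddWeight_one ho, oddPi_one ho, add_zero, mul_one] at h
  · have h1 := inv_pos.2 (oddPi_pos ho.pos (Nat.zero_le d))
    have h2 : (oddPi (d + 1) 0)⁻¹ * (1 - (oddMinorPoly d).eval (oddMu (d + 1) 1)) = 0 := by
      linear_combination h
    linarith [(mul_eq_zero.1 h2).resolve_left h1.ne']
  · intro i hi
    obtain ⟨h1, h2⟩ := Finset.mem_Ico.1 hi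
    rw [eval_oddMinorPoly_of_two_le h1 (Nat.lt_succ_iff.1 h2), mul_zero]

theorem forall_mem_eigenvalueSet_oddGraph (hd : 1 ≤ d) {p : ℝ → Prop} :
    (∀ θ ∈ eigenvalueSet (oddGraph (d + 1)), p θ) ↔ ∀ i ≤ d, p (oddMu (d + 1) i) := by
  rw [eigenvalueSet_oddGraph hd]
  simp

theorem ratioBound_oddMinorPoly (ho : Odd d) :
    ratioBound (oddGraph (d + 1)) (oddMinorPoly d) = 2 * d + 1 := by
  rw [ratioBound, sum_eigenvalueSet_oddGraph ho.pos (fun θ => (oddMinorPoly d).eval θ),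
    sum_range_eq_add_add ho.pos, eval_oddMinorPoly_zero, eval_oddMinorPoly_one ho,
    Finset.sum_eq_zero, oddMult_zero ho.pos, oddMult_one ho.pos]
  · ring
  · intro i hi
    obtain ⟨h1, h2⟩ := Finset.mem_Ico.1 hi
    rw [eval_oddMinorPoly_of_two_le h1 (Nat.lt_succ_iff.1 h2), mul_zero]

/-- Optimality follows from adding `2d π_0` times the divided difference to the objective: all
coefficients become nonnegative, and that of `μ_0` becomes `2d + 1`. -/
theorem isMinorPolynomial_oddMinorPoly (ho : Odd d) :
    IsMinorPolynomial (oddGraph (d + 1)) (d - 1) (oddMinorPoly d) := by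
  refine ⟨⟨(natDegree_oddMinorPoly ho.pos).le, ?_, ?_⟩, ?_⟩
  · rw [maxEigenvalue_oddGraph ho.pos, eval_oddMinorPoly_zero]
  · rw [forall_mem_eigenvalueSet_oddGraph ho.pos]
    intro i hi hne
    rcases Nat.lt_or_ge i 2 with h2 | h2
    · interval_cases i
      · rw [eval_oddMinorPoly_zero]; exact zero_le_one
      · rw [eval_oddMinorPoly_one ho]; exact zero_le_one
    · rw [eval_oddMinorPoly_of_two_le h2 hi]
  · rintro g ⟨hg1, hg2, hg3⟩
    rw [maxEigenvalue_oddGraph ho.pos] at hg2 hg3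
    rw [forall_mem_eigenvalueSet_oddGraph ho.pos] at hg3
    rw [ratioBound_oddMinorPoly ho, ratioBound,
      sum_eigenvalueSet_oddGraph ho.pos (fun θ => g.eval θ),
      ← sum_oddMult_add_mul_oddWeight ho.pos (2 * d * oddPi (d + 1) 0) hg1,
      Finset.sum_range_succ', hg2, oddMult_zero_add ho.pos, mul_one]
    have h : 0 ≤ ∑ i ∈ Finset.range d, (oddMult (d + 1) (i + 1)
        + 2 * d * oddPi (d + 1) 0 * oddWeight d (i + 1)) * g.eval (oddMu (d + 1) (i + 1)) := by
      refine Finset.sum_nonneg fun i hi => ?_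
      have hi := Finset.mem_range.1 hi
      refine mul_nonneg (oddMult_add_nonneg ho (by omega) (by omega)) (hg3 _ (by omega) ?_)
      intro h
      have := oddMu_injOn (d := d) (by omega) (by omega) h
      omega
    linarith

/-- Every feasible point of the program of the `(d - 1)`-sign polynomial has objective at least
`2d + 1`. Indeed an eigenvalue `μ_i` with `b = 1` and `i ≥ 2` already contributes `m_i ≥ 2d + 1`,
so assume that `s` is negative at all these. If `b` vanishes at `μ_0` or at `μ_1`, then
a multiple of the divided difference, added to the trace of `s`, turns it into a combination with
nonnegative coefficients of negative values of `s`; this contradicts that the trace is zero. -/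
theorem le_signObjective (ho : Odd d) {M : ℕ} {ε : ℝ} (hε : 0 < ε) {s : ℝ[X]} {b : ℝ → ℝ}
    (h : SignFeasible (oddGraph (d + 1)) (d - 1) M ε s b) :
    2 * (d : ℝ) + 1 ≤ signObjective (oddGraph (d + 1)) b := by
  have hd := ho.pos
  obtain ⟨hdeg, htr, hb⟩ := h
  rw [forall_mem_eigenvalueSet_oddGraph hd] at hb
  rw [sum_eigenvalueSet_oddGraph hd (fun θ => s.eval θ)] at htr
  rw [signObjective, sum_eigenvalueSet_oddGraph hd b]
  have hneg : ∀ i ≤ d, b (oddMu (d + 1) i) = 0 → s.eval (oddMu (d + 1) i) < 0 := by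
    intro i hi h0
    have := (hb i hi).2
    rw [h0] at this
    linarith
  have hterm : ∀ i ≤ d, 0 ≤ oddMult (d + 1) i * b (oddMu (d + 1) i) := by
    intro i hi
    refine mul_nonneg (Nat.cast_nonneg _) ?_
    rcases (hb i hi).1 with h | h <;> rw [h]
    exact zero_le_one
  have hrest : 0 ≤ ∑ i ∈ Finset.Ico 2 (d + 1), oddMult (d + 1) i * b (oddMu (d + 1) i) :=
    Finset.sum_nonneg fun i hi => hterm i (Nat.lt_succ_iff.1 (Finset.mem_Ico.1 hi).2)
  by_cases hex : ∃ i, 2 ≤ i ∧ i ≤ d ∧ b (oddMu (d + 1) i) = 1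
  · obtain ⟨i, h2, hi, h1⟩ := hex
    calc 2 * (d : ℝ) + 1 ≤ oddMult (d + 1) i := le_oddMult h2 hi
      _ = oddMult (d + 1) i * b (oddMu (d + 1) i) := by rw [h1, mul_one]
      _ ≤ _ := Finset.single_le_sum
        (f := fun i => oddMult (d + 1) i * b (oddMu (d + 1) i))
        (fun j hj => hterm j (Finset.mem_range_succ_iff.1 hj)) (Finset.mem_range_succ_iff.2 hi)
  · push Not at hex
    have hneg2 : ∀ i, 2 ≤ i → i ≤ d → s.eval (oddMu (d + 1) i) < 0 := fun i h2 hi =>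
      hneg i hi ((hb i hi).1.resolve_right (hex i h2 hi))
    rcases (hb 0 (Nat.zero_le d)).1 with h0 | h0
    · exfalso
      have h1 := sum_oddMult_add_mul_oddWeight hd (2 * d * oddPi (d + 1) 0) hdeg
      rw [htr, sum_range_eq_add_add hd, oddMult_one_add ho, oddMult_zero_add hd] at h1
      have h2 : ∑ i ∈ Finset.Ico 2 (d + 1), (oddMult (d + 1) i
          + 2 * d * oddPi (d + 1) 0 * oddWeight d i) * s.eval (oddMu (d + 1) i) ≤ 0 := by
        refine Finset.sum_nonpos fun i hi => ?_
        obtain ⟨h3, h4⟩ := Finset.mem_Ico.1 hi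
        exact mul_nonpos_of_nonneg_of_nonpos
          (oddMult_add_nonneg ho (by omega) (by omega)) (hneg2 i h3 (by omega)).le
      have h5 := mul_neg_of_pos_of_neg (by positivity : (0 : ℝ) < 1 + 2 * d)
        (hneg 0 (Nat.zero_le d) h0)
      linarith
    · rcases (hb 1 hd).1 with h1 | h1
      · exfalso
        have h2 := sum_oddMult_add_mul_oddWeight hd (-oddPi (d + 1) 0) hdeg
        have h3 := oddMult_zero_add hd (-1)
        rw [neg_one_mul] at h3
        rw [htr, sum_range_eq_add_add hd, h3] at h2
        have h4 : ∑ i ∈ Finset.Ico 2 (d + 1), (oddMult (d + 1) i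
            + -oddPi (d + 1) 0 * oddWeight d i) * s.eval (oddMu (d + 1) i) ≤ 0 := by
          refine Finset.sum_nonpos fun i hi => ?_
          obtain ⟨h5, h6⟩ := Finset.mem_Ico.1 hi
          exact mul_nonpos_of_nonneg_of_nonpos
            (oddMult_sub_pos ho (by omega) (by omega)).le (hneg2 i h5 (by omega)).le
        have h7 := mul_neg_of_pos_of_neg (oddMult_sub_pos ho le_rfl hd) (hneg 1 hd h1)
        linarith
      · rw [sum_range_eq_add_add hd, h0, h1, oddMult_zero hd, oddMult_one hd]
        linarith

/-- The polynomial `(n / tr f(A)) f - 1`, for `f` the minor polynomial above. -/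
noncomputable def oddSignPoly (d : ℕ) : ℝ[X] :=
  C (((2 * d + 1).choose d : ℝ) / (2 * d + 1)) * oddMinorPoly d - 1

theorem eval_oddSignPoly (d : ℕ) (x : ℝ) :
    (oddSignPoly d).eval x
      = ((2 * d + 1).choose d : ℝ) / (2 * d + 1) * (oddMinorPoly d).eval x - 1 := by
  simp [oddSignPoly]

theorem one_le_choose_div (d : ℕ) (hd : 1 ≤ d) :
    1 ≤ ((2 * d + 1).choose d : ℝ) / (2 * d + 1) := by
  have h := Nat.choose_le_middle 1 (2 * d + 1)
  rw [Nat.choose_one_right, show (2 * d + 1) / 2 = d by omega] at h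
  rw [le_div_iff₀ (by positivity), one_mul]
  exact_mod_cast h

theorem eval_oddSignPoly_of_lt_two (ho : Odd d) {i : ℕ} (hi : i < 2) :
    (oddSignPoly d).eval (oddMu (d + 1) i) = ((2 * d + 1).choose d : ℝ) / (2 * d + 1) - 1 := by
  rw [eval_oddSignPoly]
  interval_cases i
  · rw [eval_oddMinorPoly_zero, mul_one]
  · rw [eval_oddMinorPoly_one ho, mul_one]

theorem eval_oddSignPoly_of_two_le {i : ℕ} (h2 : 2 ≤ i) (hi : i ≤ d) :
    (oddSignPoly d).eval (oddMu (d + 1) i) = -1 := by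
  rw [eval_oddSignPoly, eval_oddMinorPoly_of_two_le h2 hi]; ring

theorem inertiaBound_oddSignPoly (ho : Odd d) :
    inertiaBound (oddGraph (d + 1)) (oddSignPoly d) = 2 * d + 1 := by
  classical
  have h0 : 0 ≤ ((2 * d + 1).choose d : ℝ) / (2 * d + 1) - 1 :=
    sub_nonneg.2 (one_le_choose_div d ho.pos)
  rw [inertiaBound, sum_eigenvalueSet_oddGraph ho.pos
      (fun θ => if 0 ≤ (oddSignPoly d).eval θ then (1 : ℝ) else 0),
    sum_range_eq_add_add ho.pos, Finset.sum_eq_zero,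
    eval_oddSignPoly_of_lt_two ho zero_lt_two, eval_oddSignPoly_of_lt_two ho one_lt_two,
    if_pos h0, oddMult_zero ho.pos, oddMult_one ho.pos]
  · ring
  · intro i hi
    obtain ⟨h1, h2⟩ := Finset.mem_Ico.1 hi
    rw [eval_oddSignPoly_of_two_le h1 (Nat.lt_succ_iff.1 h2), if_neg (by norm_num), mul_zero]

theorem isSignPolynomial_oddSignPoly (ho : Odd d) :
    IsSignPolynomial (oddGraph (d + 1)) (d - 1) (oddSignPoly d) := by
  classical
  have hd := ho.pos
  have h0 : 0 ≤ ((2 * d + 1).choose d : ℝ) / (2 * d + 1) - 1 :=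
    sub_nonneg.2 (one_le_choose_div d hd)
  have hε : ∀ᶠ ε : ℝ in nhdsWithin 0 (Set.Ioi 0), ε ∈ Set.Ioc (0 : ℝ) 1 :=
    Ioc_mem_nhdsGT zero_lt_one
  filter_upwards [hε] with ε hε
  filter_upwards [Filter.eventually_ge_atTop ⌈((2 * d + 1).choose d : ℝ) / (2 * d + 1)⌉₊] with M hM
  have hM : ((2 * d + 1).choose d : ℝ) / (2 * d + 1) ≤ M := Nat.ceil_le.1 hM
  refine ⟨fun θ => if 0 ≤ (oddSignPoly d).eval θ then 1 else 0, ⟨?_, ?_, ?_⟩, ?_⟩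
  · refine (natDegree_sub_le _ _).trans (max_le ?_ (by simp))
    exact (natDegree_C_mul_le _ _).trans (natDegree_oddMinorPoly hd).le
  · have h1 : ∑ i ∈ Finset.range (d + 1), oddMult (d + 1) i * (oddMinorPoly d).eval (oddMu (d + 1) i)
        = 2 * d + 1 := by
      rw [← ratioBound_oddMinorPoly ho, ratioBound,
        sum_eigenvalueSet_oddGraph hd (fun θ => (oddMinorPoly d).eval θ)]
    rw [sum_eigenvalueSet_oddGraph hd (fun θ => (oddSignPoly d).eval θ)]
    simp only [eval_oddSignPoly, mul_sub, mul_one, Finset.sum_sub_distrib, sum_oddMult hd]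
    rw [Finset.sum_congr rfl fun i _ => mul_left_comm (oddMult (d + 1) i)
      (((2 * d + 1).choose d : ℝ) / (2 * d + 1)) _, ← Finset.mul_sum, h1, div_mul_cancel₀ _ (by positivity), sub_self]
  · rw [forall_mem_eigenvalueSet_oddGraph hd]
    intro i hi
    beta_reduce
    rcases Nat.lt_or_ge i 2 with h2 | h2
    · rw [eval_oddSignPoly_of_lt_two ho h2, if_pos h0]
      exact ⟨Or.inr rfl, by linarith [hε.2]⟩
    · rw [eval_oddSignPoly_of_two_le h2 hi, if_neg (by norm_num)]
      exact ⟨Or.inl rfl, by linarith [hε.2]⟩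
  · intro s' b' h'
    have h1 := inertiaBound_oddSignPoly ho
    rw [inertiaBound] at h1
    rw [signObjective]
    convert le_signObjective ho hε.1 h'

theorem card_vertices_oddGraph (d : ℕ) :
    Fintype.card {s : Finset (Fin (2 * (d + 1) - 1)) // s.card = d + 1 - 1}
      = (2 * d + 1).choose d := by
  rw [Fintype.card_finset_len, Fintype.card_fin]; rfl

theorem isCvetkovicHoffman_oddGraph (ho : Odd d) :
    IsCvetkovicHoffman (oddGraph (d + 1)) (d - 1) where
  connected := kneserGraph_connected (n := 2 * (d + 1) - 1) (d := d) rfl ho.pos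
  regular := ⟨d + 1, kneserGraph_isRegularOfDegree (n := 2 * (d + 1) - 1) (d := d) rfl ho.pos⟩
  walkRegular := kneserGraph_isPartiallyWalkRegular _ _ _
  exists_related := by
    refine ⟨oddSignPoly d, oddMinorPoly d, isSignPolynomial_oddSignPoly ho,
      isMinorPolynomial_oddMinorPoly ho, ⟨?_, ?_⟩, ?_⟩
    · have h := one_le_choose_div d ho.pos
      have hne : ((2 * d + 1).choose d : ℝ) / (2 * d + 1) ≠ 0 := by positivity
      rw [maxEigenvalue_oddGraph ho.pos, eval_oddSignPoly_of_lt_two ho zero_lt_two,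
        add_sub_cancel, oddSignPoly, add_sub_cancel, ← mul_assoc, ← C_mul,
        one_div_mul_cancel hne, C_1, one_mul]
    · rw [ratioBound_oddMinorPoly ho, card_vertices_oddGraph, oddSignPoly]
    · rw [inertiaBound_oddSignPoly ho, ratioBound_oddMinorPoly ho]

end CvetkovicHoffman

/-! ### The bound on the independence number -/

section Bounds

variable {d : ℕ}

theorem oddPi_two_div_of_even (hd : 2 ≤ d) (he : Even d) :
    oddPi (d + 1) 2 / oddPi (d + 1) 0 = 2 * ((d : ℝ) + 1) / (d * (2 * d + 1)) := by
  obtain ⟨e, rfl⟩ := he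
  have h := oddPi_even_succ (e := e) (f := e) (t := 0) (Or.inl rfl) (by omega) (by omega)
  have hp := oddPi_pos (d := e + e) (by omega) (Nat.zero_le _)
  have he0 : (0 : ℝ) < e := by exact_mod_cast (by omega : 0 < e)
  rw [div_eq_div_iff hp.ne' (by push_cast; positivity)]
  simp only [zero_add, mul_one, mul_zero] at h
  push_cast at h ⊢
  linear_combination 2 * h

theorem oddPi_two_div_of_odd (hd : 2 ≤ d) (ho : Odd d) :
    oddPi (d + 1) 2 / oddPi (d + 1) 0 = 2 * (d : ℝ) / ((d - 1) * (2 * d + 1)) := by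
  obtain ⟨e, rfl⟩ := ho
  have h := oddPi_even_succ (e := e) (f := e + 1) (t := 0) (Or.inr rfl) (by omega) (by omega)
  have hp := oddPi_pos (d := 2 * e + 1) (by omega) (Nat.zero_le _)
  have he0 : (0 : ℝ) < e := by exact_mod_cast (by omega : 0 < e)
  rw [div_eq_div_iff hp.ne' (by push_cast; rw [add_sub_cancel_right]; positivity)]
  simp only [zero_add, mul_one, mul_zero] at h
  rw [show e + (e + 1) + 1 = 2 * e + 1 + 1 by ring] at h
  push_cast at h ⊢
  linear_combination 2 * h

theorem ratio_bound_of_even (hd : 2 ≤ d) (he : Even d) :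
    1 + oddMult (d + 1) 2 * (oddPi (d + 1) 2 / oddPi (d + 1) 0)
      = 2 * (d : ℝ) + ((d : ℝ) - 2) / d := by
  have hd' : (2 : ℝ) ≤ d := by exact_mod_cast hd
  have h0 : (d : ℝ) ≠ 0 := by linarith
  rw [oddPi_two_div_of_even hd he, oddMult_two hd]
  field_simp
  ring

theorem ratio_bound_of_odd (hd : 2 ≤ d) (ho : Odd d) :
    1 + oddMult (d + 1) 2 * (oddPi (d + 1) 2 / oddPi (d + 1) 0) = 2 * (d : ℝ) + 1 := by
  have hd' : (2 : ℝ) ≤ d := by exact_mod_cast hd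
  have h0 : (d : ℝ) - 1 ≠ 0 := by linarith
  rw [oddPi_two_div_of_odd hd ho, oddMult_two hd]
  field_simp
  ring

end Bounds

theorem proposition4p6 (d : ℕ) (hd : 1 ≤ d) :
    (2 ≤ d →
      (kIndepNum (oddGraph (d + 1)) (d - 1) : ℝ)
          ≤ 1 + oddMult (d + 1) 2 * (oddPi (d + 1) 2 / oddPi (d + 1) 0) ∧
      (Even d → 1 + oddMult (d + 1) 2 * (oddPi (d + 1) 2 / oddPi (d + 1) 0)
          = 2 * (d : ℝ) + ((d : ℝ) - 2) / d) ∧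
      (Odd d → 1 + oddMult (d + 1) 2 * (oddPi (d + 1) 2 / oddPi (d + 1) 0)
          = 2 * (d : ℝ) + 1)) ∧
    (Even (d + 1) →
      IsCvetkovicHoffman (oddGraph (d + 1)) (d - 1) ∧
      (2 ≤ d →
        oddMult (d + 1) 1 / oddMult (d + 1) 2 = oddPi (d + 1) 2 / oddPi (d + 1) 0)) := by
  refine ⟨fun h2 => ⟨?_, ratio_bound_of_even h2, ratio_bound_of_odd h2⟩, fun he => ?_⟩
  · rcases Nat.even_or_odd d with he | ho
    · have h : (kIndepNum (oddGraph (d + 1)) (d - 1) : ℝ) ≤ 2 * d := by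
        exact_mod_cast kIndepNum_oddGraph_le_of_even hd he
      have hd' : (2 : ℝ) ≤ d := by exact_mod_cast h2
      have h0 : 0 ≤ ((d : ℝ) - 2) / d := div_nonneg (by linarith) (by linarith)
      rw [ratio_bound_of_even h2 he]
      linarith
    · rw [ratio_bound_of_odd h2 ho]
      exact_mod_cast kIndepNum_oddGraph_le hd
  · have ho : Odd d := by
      rwa [Nat.even_add_one, Nat.not_even_iff_odd] at he
    refine ⟨isCvetkovicHoffman_oddGraph ho, fun h2 => ?_⟩
    have hd' : (2 : ℝ) ≤ d := by exact_mod_cast h2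
    rw [oddPi_two_div_of_odd h2 ho, oddMult_one hd, oddMult_two h2, mul_comm ((d : ℝ) - 1)]
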